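/- Let $p$ be a prime, let $v_p$ and $|\cdot|$ be the valuation (with $v_p(p)=1$, $v_p(0)=\infty$) and the absolute value of $\mathbf{C}_p$, and put $\mathcal{O}=\{|x|\le 1\}$, $\mathfrak{m}=\{|x|<1\}$. For a nonzero power series $F=\sum_i F_iX^i\in\mathbf{C}_p[[X]]$ whose coefficients attain the minimum of their valuations, $\mathrm{wideg}(F)$ denotes the smallest index $n$ with $v_p(F_n)=\min_i v_p(F_i)$, and $\mathrm{Lwideg}(F)$ denotes the largest such index, if there is one. All zeros are counted with multiplicity, the multiplicity of $z$ being the largest $k$ such that $(X-z)^k$ divides $F$ in the ring of power series converging on the disc considered. **Open disc.** Let $F,G\in\mathbf{C}_p[[X]]$ be nonzero, converge on $\mathfrak{m}$, and have finite $\mathrm{wideg}(F)=n$ and $\mathrm{wideg}(G)=N$. Then $F$ has finitely many zeros in $\mathfrak{m}$, exactly $n$ counted with multiplicity, so that $$\mathrm{Res}^o(F,G)=F_n^{N}\prod_{z\in\mathfrak{m},\,F(z)=0}G(z)$$ exists. Moreover, for all $n,N\ge 0$ there is one power series $$\Phi\in\mathbf{Z}\big[f_n,f_n^{-1},\{f_k\}_{k>n},\{g_k\}_{k\ge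 0}\big][[f_0,\dots,f_{n-1}]]$$ in independent variables such that for all such $F,G$ with $F_n\in\mathcal{O}^\times$, substituting $f_k=F_k$, $g_k=G_k$ in $\Phi$ gives a convergent sum over the monomials in $f_0,\dots,f_{n-1}$, with sum $\mathrm{Res}^o(F,G)$. **Closed disc.** Every nonzero $F\in\mathbf{C}_p[[X]]$ converging on $\mathcal{O}$ has a finite $\mathrm{Lwideg}(F)$. Let $F,G$ be nonzero and converge on $\mathcal{O}$, with $\mathrm{Lwideg}(F)=m$ and $\mathrm{Lwideg}(G)=M$. Then $F$ has finitely many zeros in $\mathcal{O}$, exactly $m$ counted with multiplicity, so that $$\mathrm{Res}^c(F,G)=F_m^{M}\prod_{z\in\mathcal{O},\,F(z)=0}G(z)$$ exists. Moreover, for all $m,M\ge 0$ there is one power series $\Phi\in\mathbf{Z}[f_m,f_m^{-1},\{f_k\}_{k>m},\{g_k\}_{k\ge0}][[f_0,\dots,f_{m-1}]]$ such that for all such $F,G$ with $F_m\in\mathcal{O}^\times$ the same substitution converges to $\mathrm{Res}^c(F,G)$. **Comparison with distinguished polynomials.** In the open case, a distinguished polynomial of $F$ is a monic polynomial $P$ of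 degree $n$ with lower coefficients in $\mathfrak{m}$ such that $F=F_nPU$ with $U\in\mathcal{O}[[X]]^\times$. In the closed case, it is a monic polynomial $P$ of degree $m$ such that $F=F_mPh$, where $h$ converges on $\mathcal{O}$, has constant coefficient in $\mathcal{O}^\times$, and has all other coefficients in $\mathfrak{m}$. Let $D=\mathfrak{m}$ or $D=\mathcal{O}$, let $F,G$ be as in the corresponding case above, write $n,N$ for their degrees ($\mathrm{wideg}$ or $\mathrm{Lwideg}$ respectively) and $\mathrm{Res}(F,G)$ for the corresponding resultant. Then distinguished polynomials $P$ of $F$ and $Q$ of $G$ exist, and for any such $P,Q$ $$v_p(\mathrm{Res}(F,G))=v_p(\mathrm{Res}(F_nP,G_NQ)),$$ $$\mathrm{Res}(F_nP,G_NQ)=F_n^NG_N^n\prod_{i=1}^{n}\prod_{j=1}^{N}(z_i-w_j)=\det \mathrm{Syl}(F_nP,G_NQ),$$ where $z_1,\dots,z_n$ and $w_1,\dots,w_N$ are the zeros of $F$ and of $G$ in $D$, with multiplicity. If moreover $F,G\in\mathcal{O}[[X]]$, and if it is not the case that $n=N=0$ with both $F_0$ and $G_0$ non-units of $\mathcal{O}$,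 then $$S:=\sup_{x\in D}\min\big(v_p(F(x)),v_p(G(x))\big)\le v_p(\mathrm{Res}(F_nP,G_NQ)).$$ -/

import Mathlib

noncomputable section

namespace PadicResultant

variable {p : ℕ} [Fact p.Prime]

/-- The open unit disc (the maximal ideal of the ring of integers of `ℂ_[p]`). -/
def openDisc (p : ℕ) [Fact p.Prime] : Set ℂ_[p] := {x | ‖x‖ < 1}

/-- The closed unit disc (the ring of integers of `ℂ_[p]`). -/
def closedDisc (p : ℕ) [Fact p.Prime] : Set ℂ_[p] := {x | ‖x‖ ≤ 1}

open Classical in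
/-- The additive `p`-adic valuation on `ℂ_[p]`, normalised by `vp p = 1`, with `vp 0 = ∞`. -/
def vp (x : ℂ_[p]) : EReal := if x = 0 then ⊤ else ((-Real.logb p ‖x‖ : ℝ) : EReal)

/-- The power series `F` converges at every point of `D`. -/
def ConvergesOn (D : Set ℂ_[p]) (F : PowerSeries ℂ_[p]) : Prop :=
  ∀ x ∈ D, Summable fun i : ℕ => PowerSeries.coeff i F * x ^ i

/-- The value of a power series at a point (meaningful where it converges). -/
def evalAt (F : PowerSeries ℂ_[p]) (x : ℂ_[p]) : ℂ_[p] :=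
  ∑' i : ℕ, PowerSeries.coeff i F * x ^ i

/-- `F` has Weierstrass degree `n`: `n` is the smallest index at which the valuation of the
coefficients attains its minimum (and this minimum is finite, that is, `F ≠ 0`). -/
def IsWideg (F : PowerSeries ℂ_[p]) (n : ℕ) : Prop :=
  PowerSeries.coeff n F ≠ 0 ∧
    (∀ i, ‖PowerSeries.coeff i F‖ ≤ ‖PowerSeries.coeff n F‖) ∧
    ∀ i < n, ‖PowerSeries.coeff i F‖ < ‖PowerSeries.coeff n F‖

/-- `F` has closed-disc degree `m`: `m` is the largest index at which the valuation of the
coefficients attains its minimum. -/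
def IsLwideg (F : PowerSeries ℂ_[p]) (m : ℕ) : Prop :=
  PowerSeries.coeff m F ≠ 0 ∧
    (∀ i, ‖PowerSeries.coeff i F‖ ≤ ‖PowerSeries.coeff m F‖) ∧
    ∀ i > m, ‖PowerSeries.coeff i F‖ < ‖PowerSeries.coeff m F‖

/-- The zeros of `F` in `D`. -/
def zeros (D : Set ℂ_[p]) (F : PowerSeries ℂ_[p]) : Set ℂ_[p] :=
  {z | z ∈ D ∧ evalAt F z = 0}

/-- The multiplicity of `z` as a zero of `F`: the largest `k` such that `(X - z) ^ k` divides `F`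
in the ring of power series converging on `D`. -/
def zeroMult (D : Set ℂ_[p]) (F : PowerSeries ℂ_[p]) (z : ℂ_[p]) : ℕ :=
  sSup {k : ℕ | ∃ H : PowerSeries ℂ_[p],
    ConvergesOn D H ∧ F = (PowerSeries.X - PowerSeries.C z) ^ k * H}

/-- The resultant of `F` and `G` over `D`, where `F`, `G` have degrees `n`, `N`: the product of
`(coeff n F) ^ N` and of the values of `G` at the zeros of `F` in `D`, counted with multiplicity. -/
def discResultant (D : Set ℂ_[p]) (n N : ℕ) (F G : PowerSeries ℂ_[p]) : ℂ_[p] :=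
  PowerSeries.coeff n F ^ N * ∏ᶠ z ∈ zeros D F, evalAt G z ^ zeroMult D F z

/-- `Res^o`, the resultant on the open unit disc. -/
def resO (n N : ℕ) (F G : PowerSeries ℂ_[p]) : ℂ_[p] := discResultant (openDisc p) n N F G

/-- `Res^c`, the resultant on the closed unit disc. -/
def resC (m M : ℕ) (F G : PowerSeries ℂ_[p]) : ℂ_[p] := discResultant (closedDisc p) m M F G

/-- The ring `ℤ[f_n, f_n⁻¹, {f_k}_{k > n}, {g_k}_{k ≥ 0}]` in independent variables: `Sum.inl k` is
the variable `f_k` (for `k ≥ n`), `Sum.inr k` is the variable `g_k`. -/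
abbrev UnivCoeff (n : ℕ) : Type :=
  Localization.Away (MvPolynomial.X (Sum.inl ⟨n, le_rfl⟩) :
    MvPolynomial ({k : ℕ // n ≤ k} ⊕ ℕ) ℤ)

/-- The specialisation `f_k ↦ coeff k F`, `g_k ↦ coeff k G` before inverting `f_n`. -/
def specializePoly (n : ℕ) (F G : PowerSeries ℂ_[p]) :
    MvPolynomial ({k : ℕ // n ≤ k} ⊕ ℕ) ℤ →+* ℂ_[p] :=
  MvPolynomial.eval₂Hom (Int.castRingHom ℂ_[p])
    (Sum.elim (fun k => PowerSeries.coeff k.1 F) (fun k => PowerSeries.coeff k G))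

/-- The specialisation `f_k ↦ coeff k F` (`k ≥ n`), `g_k ↦ coeff k G` on `UnivCoeff n`. -/
def specialize (n : ℕ) (F G : PowerSeries ℂ_[p]) (h : PowerSeries.coeff n F ≠ 0) :
    UnivCoeff n →+* ℂ_[p] :=
  Localization.awayLift (specializePoly n F G) _
    (by simpa [specializePoly] using h)

/-- `r` is the value of the power series `Φ` in `n` variables `f_0, …, f_{n-1}` over
`ℤ[f_n, f_n⁻¹, {f_k}_{k > n}, {g_k}]` at the coefficients of `F` and `G`, as a convergent sum. -/
def HasUnivValue (n : ℕ) (Φ : MvPowerSeries (Fin n) (UnivCoeff n)) (F G : PowerSeries ℂ_[p])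
    (h : PowerSeries.coeff n F ≠ 0) (r : ℂ_[p]) : Prop :=
  HasSum (fun a : Fin n →₀ ℕ =>
    specialize n F G h (MvPowerSeries.coeff a Φ) *
      ∏ i : Fin n, PowerSeries.coeff (i : ℕ) F ^ a i) r

/-- `P` is the distinguished polynomial of `F` for the open disc, `n` being the Weierstrass degree:
`P` is monic of degree `n`, its lower coefficients lie in the maximal ideal, and `F = F_n P U`
where `U` is a unit of the ring of power series with integral coefficients. -/
def IsDistinguishedO (F : PowerSeries ℂ_[p]) (n : ℕ) (P : Polynomial ℂ_[p]) : Prop :=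
  P.Monic ∧ P.natDegree = n ∧ (∀ i < n, ‖P.coeff i‖ < 1) ∧
    ∃ U : PowerSeries ℂ_[p],
      ‖PowerSeries.coeff 0 U‖ = 1 ∧ (∀ i, ‖PowerSeries.coeff i U‖ ≤ 1) ∧
      F = PowerSeries.C (PowerSeries.coeff n F) * (P : PowerSeries ℂ_[p]) * U

/-- `P` is the distinguished polynomial of `F` for the closed disc, `m` being the closed-disc
degree: `P` is monic of degree `m` and `F = F_m P h` where `h` converges on the closed disc, has a
unit as its constant coefficient and has all its other coefficients in the maximal ideal (so that
`h` has no zero on the closed disc). -/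
def IsDistinguishedC (F : PowerSeries ℂ_[p]) (m : ℕ) (P : Polynomial ℂ_[p]) : Prop :=
  P.Monic ∧ P.natDegree = m ∧
    ∃ h : PowerSeries ℂ_[p],
      ConvergesOn (closedDisc p) h ∧
      ‖PowerSeries.coeff 0 h‖ = 1 ∧ (∀ i > 0, ‖PowerSeries.coeff i h‖ < 1) ∧
      F = PowerSeries.C (PowerSeries.coeff m F) * (P : PowerSeries ℂ_[p]) * h

/-- All coefficients of `F` lie in the ring of integers of `ℂ_[p]`. -/
def HasIntegralCoeffs (F : PowerSeries ℂ_[p]) : Prop := ∀ i, ‖PowerSeries.coeff i F‖ ≤ 1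

/-- The resultant over `D` exists: `F` has finitely many zeros in `D`, with finite positive
multiplicities (an infinite multiplicity would be recorded as `0`) of sum `n`, and `G` converges at
each of them. -/
def ResultantExists (D : Set ℂ_[p]) (n : ℕ) (F G : PowerSeries ℂ_[p]) : Prop :=
  (zeros D F).Finite ∧ (∀ z ∈ zeros D F, 1 ≤ zeroMult D F z) ∧
    ∑ᶠ z ∈ zeros D F, zeroMult D F z = n ∧
    ∀ z ∈ zeros D F, Summable fun i : ℕ => PowerSeries.coeff i G * z ^ i

/-- `S`: the supremum over `x` in `D` of `min (vp (F x)) (vp (G x))`. -/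
def supMin (D : Set ℂ_[p]) (F G : PowerSeries ℂ_[p]) : EReal :=
  ⨆ x ∈ D, min (vp (evalAt F x)) (vp (evalAt G x))

/-- What is claimed about the resultant `r` over `D` of `F` and `G` (of degrees `n` and `N`) and
the polynomials `f = F_n P` and `g = G_N Q`: equality of valuations, the product formula for the
Sylvester determinant, and the bound for `S`. -/
def ResultantComparison (D : Set ℂ_[p]) (n N : ℕ) (F G : PowerSeries ℂ_[p]) (r : ℂ_[p])
    (f g : Polynomial ℂ_[p]) : Prop :=
  vp r = vp (f.resultant g) ∧
  f.resultant g = PowerSeries.coeff n F ^ N * PowerSeries.coeff N G ^ n *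
    ∏ᶠ z ∈ zeros D F, ∏ᶠ w ∈ zeros D G, (z - w) ^ (zeroMult D F z * zeroMult D G w) ∧
  f.resultant g = (f.sylvester g n N).det ∧
  (HasIntegralCoeffs F → HasIntegralCoeffs G →
    ¬ (n = 0 ∧ N = 0 ∧ ‖PowerSeries.coeff n F‖ < 1 ∧ ‖PowerSeries.coeff N G‖ < 1) →
    supMin D F G ≤ vp (f.resultant g))

end PadicResultant

end

open PadicResultant

noncomputable section

namespace PadicResultant

set_option linter.unusedSectionVars false

open Filter Topology Finset

/-! ### Convergence and evaluation of power series over ultrametric fields -/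

section Evaluation

variable {K : Type*} [NormedField K] [IsUltrametricDist K]

/-! The engine is a Weierstrass preparation carried out once, formally. Treat `f_0, …, f_{n-1}` as
variables over a ring in which `f_n` is a unit and write the generic series as `L + X^n V`, with `L`
the low part and `V` invertible. A series `W` makes `W V⁻¹ (L + X^n V)` a monic polynomial of degree
`n` exactly when `W + dropLow n (W V⁻¹ L) = 1`. Since `L` vanishes at the origin of the variables, a
Neumann series solves this equation (`exists_add_dropLow_mul_eq_one`). If `C` is the companion
matrix of the resulting polynomial `P`, the universal resultant is `f_n ^ N * det (∑ g_k C ^ k)`,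
because `det q(C)` is the product of the values of `q` at the roots of `P` (`det_aeval_companion`).

Convergence is governed by weights. Give `f_i` the weight `n - i`, for `i ≥ n` as well. The
construction is homogeneous, so the coefficient of a monomial `a` in `f_0, …, f_{n-1}` involves
products of `f_{n+k}` with prescribed total `k`, which grows with `wt a`. A gauge `ω` with
`‖f_{n+k}‖ ≤ ω k` and `ω v * ω w ≤ ω (v + w)` therefore bounds these coefficients by `ω (wt a +
shift)`. The vanishing of `ω` in negative weights also makes `∑ g_k C ^ k` a finite sum in each
coefficient (`weightBounded_compMatrix_pow`). On the open disc `ω` is constantly `1` in nonnegative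
weights, and the low coefficients, of norm `< 1`, provide convergence. On the closed disc they may
have norm `1`, and convergence comes from a gauge tending to `0` (`exists_gauge`). In both cases
evaluation is a ring homomorphism on convergent series, and truncating `G` gives the value of the
determinant (`hasSum_resultantSeries`).

For the comparison, `F = F_n P h` with `‖h‖ = 1` on the disc and all roots of `P` in the disc
(`IsPrepared`). Zeros and multiplicities of `F` are then those of `P`, and replacing `G` by `G_N Q`
changes the resultant by a factor of norm `1`. The bound on `S` is the identity `Res(f, g) = a f + b
g` with integral `a`, `b`, evaluated at a point of the disc. -/

instance nonarchimedeanRing_of_isUltrametricDist : NonarchimedeanRing K where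
  is_nonarchimedean := NonarchimedeanAddGroup.is_nonarchimedean

theorem norm_sub_le_max (x y : K) : ‖x - y‖ ≤ max ‖x‖ ‖y‖ := by
  simpa [sub_eq_add_neg] using IsUltrametricDist.norm_add_le_max x (-y)

/-- The Cauchy product formula in a nonarchimedean field. -/
theorem hasSum_antidiagonal {ι : Type*} [AddCommMonoid ι] [HasAntidiagonal ι] {f g : ι → K}
    (hf : Summable f) (hg : Summable g) :
    HasSum (fun a => ∑ x ∈ antidiagonal a, f x.1 * g x.2) ((∑' a, f a) * ∑' a, g a) := by
  have h := hf.mul_of_nonarchimedean hg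
  rw [hf.tsum_mul_tsum_eq_tsum_sum_antidiagonal hg h]
  exact (summable_sum_mul_antidiagonal_of_summable_mul h).hasSum

theorem summable_coeff_mul {F G : PowerSeries K} {x : K}
    (hF : Summable fun i => PowerSeries.coeff i F * x ^ i)
    (hG : Summable fun i => PowerSeries.coeff i G * x ^ i) :
    HasSum (fun i => PowerSeries.coeff i (F * G) * x ^ i)
      ((∑' i, PowerSeries.coeff i F * x ^ i) * ∑' i, PowerSeries.coeff i G * x ^ i) := by
  convert hasSum_antidiagonal hF hG using 2 with i
  rw [PowerSeries.coeff_mul, Finset.sum_mul]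
  refine Finset.sum_congr rfl fun y hy => ?_
  rw [← mem_antidiagonal.mp hy, pow_add]
  ring

variable {σ : Type*} [Fintype σ]

/-- The value of the monomial with exponent `a` at `x`. -/
def monomialValue (x : σ → K) (a : σ →₀ ℕ) : K := ∏ i, x i ^ a i

theorem monomialValue_zero (x : σ → K) : monomialValue x 0 = 1 := by simp [monomialValue]

theorem monomialValue_add (x : σ → K) (a b : σ →₀ ℕ) :
    monomialValue x (a + b) = monomialValue x a * monomialValue x b := by
  simp [monomialValue, pow_add, Finset.prod_mul_distrib]

theorem norm_monomialValue_le_pow {x : σ → K} {r : ℝ} (hx : ∀ i, ‖x i‖ ≤ r) (a : σ →₀ ℕ) :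
    ‖monomialValue x a‖ ≤ r ^ a.degree := by
  rw [monomialValue, norm_prod, Finsupp.degree_eq_sum, ← Finset.prod_pow_eq_pow_sum]
  refine Finset.prod_le_prod (fun _ _ => norm_nonneg _) fun i _ => ?_
  rw [norm_pow]
  gcongr
  exact hx i

/-- The series `Ψ` converges at the point `x`. -/
def ConvergesAt (x : σ → K) (Ψ : MvPowerSeries σ K) : Prop :=
  Summable fun a => MvPowerSeries.coeff a Ψ * monomialValue x a

/-- The value at `x` of a power series in several variables. -/
def mvEval (x : σ → K) (Ψ : MvPowerSeries σ K) : K :=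
  ∑' a, MvPowerSeries.coeff a Ψ * monomialValue x a

theorem hasSum_mvEval_mul {x : σ → K} {Ψ Θ : MvPowerSeries σ K} (hΨ : ConvergesAt x Ψ)
    (hΘ : ConvergesAt x Θ) :
    HasSum (fun a => MvPowerSeries.coeff a (Ψ * Θ) * monomialValue x a)
      (mvEval x Ψ * mvEval x Θ) := by
  classical
  unfold mvEval
  convert hasSum_antidiagonal hΨ hΘ using 2 with a
  rw [MvPowerSeries.coeff_mul, Finset.sum_mul]
  refine Finset.sum_congr rfl fun y hy => ?_
  rw [← mem_antidiagonal.mp hy, monomialValue_add]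
  ring

theorem hasSum_mvEval_C (x : σ → K) (c : K) :
    HasSum (fun a => MvPowerSeries.coeff a (MvPowerSeries.C c : MvPowerSeries σ K) *
      monomialValue x a) c := by
  classical
  convert hasSum_ite_eq (0 : σ →₀ ℕ) c using 2 with a
  rw [MvPowerSeries.coeff_C]
  split_ifs with h
  · simp [h, monomialValue_zero]
  · simp

theorem hasSum_mvEval_X (x : σ → K) (i : σ) :
    HasSum (fun a => MvPowerSeries.coeff a (MvPowerSeries.X i : MvPowerSeries σ K) *
      monomialValue x a) (x i) := by
  classical
  convert hasSum_ite_eq (Finsupp.single i 1) (x i) using 2 with a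
  rw [MvPowerSeries.coeff_X]
  split_ifs with h
  · rw [h, monomialValue, Finset.prod_eq_single i]
    · simp
    · intro j _ hj
      simp [Finsupp.single_eq_of_ne hj]
    · simp
  · simp

/-- The subring of the power series that converge at `x`. -/
def convergentSubring (x : σ → K) : Subring (MvPowerSeries σ K) where
  carrier := {Ψ | ConvergesAt x Ψ}
  mul_mem' hΨ hΘ := (hasSum_mvEval_mul hΨ hΘ).summable
  one_mem' := by simpa [ConvergesAt] using (hasSum_mvEval_C x (1 : K)).summable
  zero_mem' := by simp [ConvergesAt]
  add_mem' hΨ hΘ := by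
    simpa [ConvergesAt, add_mul] using hΨ.add hΘ
  neg_mem' hΨ := by
    simpa [ConvergesAt] using hΨ.neg

/-- Evaluation at `x` of the power series that converge there. -/
def mvEvalHom (x : σ → K) : convergentSubring x →+* K where
  toFun Ψ := mvEval x Ψ.1
  map_one' := by simpa [mvEval] using (hasSum_mvEval_C x (1 : K)).tsum_eq
  map_zero' := by simp [mvEval]
  map_mul' Ψ Θ := (hasSum_mvEval_mul Ψ.2 Θ.2).tsum_eq
  map_add' Ψ Θ := by
    have h := Summable.tsum_add (f := fun a => MvPowerSeries.coeff a Ψ.1 * monomialValue x a)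
      (g := fun a => MvPowerSeries.coeff a Θ.1 * monomialValue x a) Ψ.2 Θ.2
    simpa [mvEval, add_mul] using h

@[simp] theorem mvEvalHom_apply (x : σ → K) (Ψ : convergentSubring x) :
    mvEvalHom x Ψ = mvEval x Ψ.1 := rfl

theorem mvEval_C (x : σ → K) (c : K) : mvEval x (MvPowerSeries.C c) = c :=
  (hasSum_mvEval_C x c).tsum_eq

theorem mvEval_X (x : σ → K) (i : σ) : mvEval x (MvPowerSeries.X i) = x i :=
  (hasSum_mvEval_X x i).tsum_eq

theorem norm_mvEval_le {x : σ → K} {Ψ : MvPowerSeries σ K} {c : ℝ} (hc : 0 ≤ c)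
    (h : ∀ a, ‖MvPowerSeries.coeff a Ψ‖ * ‖monomialValue x a‖ ≤ c) : ‖mvEval x Ψ‖ ≤ c :=
  IsUltrametricDist.norm_tsum_le_of_forall_le_of_nonneg hc fun a => by
    rw [norm_mul]
    exact h a

variable [CompleteSpace K]

theorem summable_of_norm_le_of_tendsto {ι : Type*} {f : ι → K} {g : ι → ℝ}
    (hg : Tendsto g cofinite (𝓝 0)) (h : ∀ i, ‖f i‖ ≤ g i) : Summable f :=
  NonarchimedeanAddGroup.summable_of_tendsto_cofinite_zero (squeeze_zero_norm h hg)

end Evaluation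

/-! ### Companion matrices and products over roots -/

section Companion

variable {R : Type*} [CommRing R]

/-- The companion matrix of a monic polynomial of degree `n` with lower coefficients `c`. -/
def companion {n : ℕ} (c : Fin n → R) : Matrix (Fin n) (Fin n) R :=
  Matrix.of fun i j => if (j : ℕ) + 1 = n then -c i else if (i : ℕ) = j + 1 then 1 else 0

theorem companion_map {S : Type*} [CommRing S] {n : ℕ} (c : Fin n → R) (φ : R →+* S) :
    (companion c).map φ = companion fun i => φ (c i) := by
  ext i j
  simp only [companion, Matrix.map_apply, Matrix.of_apply]
  split_ifs <;> simp

/-- This is the matrix of multiplication by the root in the power basis of `K[X]/(P)`. Its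
characteristic polynomial is the minimal polynomial of the root. -/
theorem charpoly_companion {K : Type*} [Field K] {P : Polynomial K} (hP : P.Monic) :
    (companion fun i : Fin P.natDegree => P.coeff i).charpoly = P := by
  have h1 := charpoly_leftMulMatrix (AdjoinRoot.powerBasis' hP)
  rw [PowerBasis.leftMulMatrix] at h1
  have h2 : minpoly K (AdjoinRoot.powerBasis' hP).gen = P := by
    rw [AdjoinRoot.powerBasis'_gen, AdjoinRoot.minpoly_root hP.ne_zero, hP.leadingCoeff]
    simp
  have h3 : (AdjoinRoot.powerBasis' hP).minpolyGen = P := by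
    rw [PowerBasis.minpolyGen_eq, h2]
  rw [h2, h3] at h1
  exact h1

/-- Both sides are multiplicative in `q`, so over an algebraically closed field it suffices to treat
constants and factors `X - r`. For the latter, `det (r - C)` is `P(r)` by the characteristic
polynomial. -/
theorem det_aeval_companion {K : Type*} [Field K] [IsAlgClosed K] {P : Polynomial K}
    (hP : P.Monic) (q : Polynomial K) :
    (Polynomial.aeval (companion fun i : Fin P.natDegree => P.coeff i) q).det =
      (P.roots.map fun z => q.eval z).prod := by
  set M := companion fun i : Fin P.natDegree => P.coeff i with hM
  have hPs := IsAlgClosed.splits P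
  have hcard : P.roots.card = P.natDegree := Polynomial.splits_iff_card_roots.mp hPs
  have hPr : P = (P.roots.map fun z => Polynomial.X - Polynomial.C z).prod := by
    conv_lhs => rw [hPs.eq_prod_roots, hP.leadingCoeff, map_one, one_mul]
  let lhs : Polynomial K →* K :=
    { toFun := fun q => (Polynomial.aeval M q).det
      map_one' := by simp
      map_mul' := fun a b => by rw [map_mul, Matrix.det_mul] }
  let rhs : Polynomial K →* K :=
    { toFun := fun q => (P.roots.map fun z => q.eval z).prod
      map_one' := by simp
      map_mul' := fun a b => by simp [Multiset.prod_map_mul] }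
  have hC : ∀ c : K, lhs (Polynomial.C c) = rhs (Polynomial.C c) := fun c => by
    change (Polynomial.aeval M (Polynomial.C c)).det = (P.roots.map fun z => _).prod
    rw [Polynomial.aeval_C, Matrix.algebraMap_eq_diagonal, Matrix.det_diagonal]
    simp [hcard]
  have hX : ∀ r : K, lhs (Polynomial.X - Polynomial.C r) = rhs (Polynomial.X - Polynomial.C r) :=
    fun r => by
      change (Polynomial.aeval M (Polynomial.X - Polynomial.C r)).det =
        (P.roots.map fun z => _).prod
      have h1 : Polynomial.aeval M (Polynomial.X - Polynomial.C r) =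
          -(Matrix.scalar (Fin P.natDegree) r - M) := by
        simp [Matrix.algebraMap_eq_diagonal, Matrix.scalar_apply, Pi.algebraMap_def]
      have h2 : P.eval r = (P.roots.map fun z => r - z).prod := by
        conv_lhs => rw [hPr, Polynomial.eval_multiset_prod, Multiset.map_map]
        simp
      -- The sign `(-1) ^ n` is distributed over the `n` factors `r - z`, turning each into `z - r`.
      rw [h1, Matrix.det_neg, ← Matrix.eval_charpoly, charpoly_companion hP, h2, Fintype.card_fin,
        ← hcard]
      rw [← Multiset.card_map (fun z => r - z), ← Multiset.prod_map_neg, Multiset.map_map]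
      simp
  change lhs q = rhs q
  rw [(IsAlgClosed.splits q).eq_prod_roots, map_mul, map_mul, hC, map_multiset_prod,
    map_multiset_prod, Multiset.map_map, Multiset.map_map]
  congr 3
  exact funext hX

end Companion

/-! ### Formal Weierstrass factorisation of the generic series -/

section FormalFactorization

variable {R : Type*} [CommRing R]

/-- Drop the coefficients of index `< n` and divide by `X ^ n`. -/
def dropLow (n : ℕ) (S : PowerSeries R) : PowerSeries R :=
  PowerSeries.mk fun i => PowerSeries.coeff (i + n) S

@[simp] theorem coeff_dropLow (n i : ℕ) (S : PowerSeries R) :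
    PowerSeries.coeff i (dropLow n S) = PowerSeries.coeff (i + n) S := by
  simp [dropLow]

theorem dropLow_add (n : ℕ) (S T : PowerSeries R) :
    dropLow n (S + T) = dropLow n S + dropLow n T := by
  ext i; simp

theorem dropLow_sub (n : ℕ) (S T : PowerSeries R) :
    dropLow n (S - T) = dropLow n S - dropLow n T := by
  ext i; simp

theorem map_dropLow {S : Type*} [CommRing S] (φ : R →+* S) (n : ℕ) (F : PowerSeries R) :
    PowerSeries.map φ (dropLow n F) = dropLow n (PowerSeries.map φ F) := by
  ext i; simp

variable {A : Type*} [CommRing A] {σ : Type*}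

/-- All coefficients of `S` have order at least `d` in the variables of `MvPowerSeries σ A`. -/
def OrderGE (d : ℕ) (S : PowerSeries (MvPowerSeries σ A)) : Prop :=
  ∀ i (a : σ →₀ ℕ), a.degree < d → MvPowerSeries.coeff a (PowerSeries.coeff i S) = 0

theorem OrderGE.add {d : ℕ} {S T : PowerSeries (MvPowerSeries σ A)} (hS : OrderGE d S)
    (hT : OrderGE d T) : OrderGE d (S + T) := fun i a ha => by
  simp [hS i a ha, hT i a ha]

theorem OrderGE.sub {d : ℕ} {S T : PowerSeries (MvPowerSeries σ A)} (hS : OrderGE d S)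
    (hT : OrderGE d T) : OrderGE d (S - T) := fun i a ha => by
  simp [hS i a ha, hT i a ha]

theorem OrderGE.mul {d e : ℕ} {S T : PowerSeries (MvPowerSeries σ A)} (hS : OrderGE d S)
    (hT : OrderGE e T) : OrderGE (d + e) (S * T) := fun i a ha => by
  classical
  rw [PowerSeries.coeff_mul, map_sum]
  refine Finset.sum_eq_zero fun x _ => ?_
  rw [MvPowerSeries.coeff_mul]
  refine Finset.sum_eq_zero fun y hy => ?_
  have h : y.1.degree + y.2.degree = a.degree := by
    rw [← mem_antidiagonal.mp hy, map_add]
  rcases lt_or_ge y.1.degree d with h1 | h1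
  · rw [hS _ _ h1, zero_mul]
  · rw [hT _ _ (by omega), mul_zero]

theorem OrderGE.dropLow {d : ℕ} {S : PowerSeries (MvPowerSeries σ A)} (hS : OrderGE d S) (n : ℕ) :
    OrderGE d (dropLow n S) := fun i a ha => by
  simp [hS (i + n) a ha]

theorem eq_zero_of_orderGE {S : PowerSeries (MvPowerSeries σ A)} (h : ∀ d, OrderGE d S) :
    S = 0 := by
  ext i a
  simpa using h (a.degree + 1) i a (Nat.lt_succ_self _)

/-- The operator `W ↦ dropLow n (W * B)` is topologically nilpotent when `B` vanishes at the origin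
of the coefficient variables, so that `1` plus this operator is onto. -/
theorem exists_add_dropLow_mul_eq_one (n : ℕ) (B : PowerSeries (MvPowerSeries σ A))
    (hB : OrderGE 1 B) : ∃ W, W + dropLow n (W * B) = 1 := by
  -- The terms of the Neumann series. Each application of the operator raises the order by one
  -- because `B` has order at least `1`.
  let w : ℕ → PowerSeries (MvPowerSeries σ A) := fun s => (fun S => -dropLow n (S * B))^[s] 1
  have hw0 : w 0 = 1 := rfl
  have hw1 : ∀ s, w (s + 1) = -dropLow n (w s * B) := fun s =>
    Function.iterate_succ_apply' (fun S => -dropLow n (S * B)) s 1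
  have hord : ∀ s, OrderGE s (w s) := by
    intro s
    induction s with
    | zero => intro i a ha; omega
    | succ s ih =>
      intro i a ha
      rw [hw1, map_neg, map_neg, ((ih.mul hB).dropLow n) i a ha, neg_zero]
  let T : ℕ → PowerSeries (MvPowerSeries σ A) := fun D => ∑ s ∈ range D, w s
  have hT : ∀ D, T D + dropLow n (T D * B) = 1 - w D := by
    intro D
    induction D with
    | zero => ext i; simp [T, hw0]
    | succ D ih =>
      have h : T (D + 1) = T D + w D := Finset.sum_range_succ _ _
      rw [h, add_mul, dropLow_add, hw1]
      linear_combination ih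
  -- The coefficient at `a` no longer changes once `a.degree + 1` terms have been summed, so this is
  -- the limit of the partial sums.
  let c : ℕ → MvPowerSeries σ A := fun i a =>
    MvPowerSeries.coeff a (PowerSeries.coeff i (T (a.degree + 1)))
  let W : PowerSeries (MvPowerSeries σ A) := PowerSeries.mk c
  have hW : ∀ D, OrderGE D (W - T D) := by
    intro D i a ha
    have h1 : MvPowerSeries.coeff a (PowerSeries.coeff i W) =
        MvPowerSeries.coeff a (PowerSeries.coeff i (T (a.degree + 1))) := by
      rw [PowerSeries.coeff_mk]
      rfl
    have h2 : ∀ E, a.degree + 1 ≤ E → MvPowerSeries.coeff a (PowerSeries.coeff i (T E)) =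
        MvPowerSeries.coeff a (PowerSeries.coeff i (T (a.degree + 1))) := by
      intro E hE
      induction E, hE using Nat.le_induction with
      | base => rfl
      | succ E hE ih =>
        have h : T (E + 1) = T E + w E := Finset.sum_range_succ _ _
        rw [h, map_add, map_add, ih, hord E i a (by omega), add_zero]
    rw [map_sub, map_sub, h1, h2 D ha, sub_self]
  refine ⟨W, ?_⟩
  rw [← sub_eq_zero]
  refine eq_zero_of_orderGE fun D => ?_
  have h : W + dropLow n (W * B) - 1 =
      (W - T D) + dropLow n ((W - T D) * B) - w D := by
    rw [sub_mul, dropLow_sub]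
    linear_combination hT D
  rw [h]
  refine ((hW D).add ?_).sub (hord D)
  intro i a ha
  exact (((hW D).mul hB).dropLow n) i a (by omega)

variable (n : ℕ)

/-- The polynomial `∑_{i < n} X_i X ^ i` with independent coefficients. -/
def lowPart (A : Type*) [CommRing A] : PowerSeries (MvPowerSeries (Fin n) A) :=
  PowerSeries.mk fun i => if h : i < n then MvPowerSeries.X ⟨i, h⟩ else 0

/-- The power series `∑_k f_{n + k} X ^ k`. -/
def highPart (f : ℕ → A) : PowerSeries (MvPowerSeries (Fin n) A) :=
  PowerSeries.mk fun k => MvPowerSeries.C (f (n + k))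

/-- The power series with independent coefficients in degrees `< n`, and coefficients `f_k` in
degrees `k ≥ n`. -/
def genericSeries (f : ℕ → A) : PowerSeries (MvPowerSeries (Fin n) A) :=
  lowPart n A + PowerSeries.X ^ n * highPart n f

theorem coeff_genericSeries (f : ℕ → A) (i : ℕ) :
    PowerSeries.coeff i (genericSeries n f) =
      if h : i < n then MvPowerSeries.X ⟨i, h⟩ else MvPowerSeries.C (f i) := by
  rw [genericSeries, map_add, PowerSeries.coeff_X_pow_mul']
  by_cases h : i < n
  · simp [h, lowPart, not_le.mpr h]
  · simp [h, lowPart, highPart, not_lt.mp h, Nat.add_sub_cancel' (not_lt.mp h)]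

theorem orderGE_lowPart : OrderGE 1 (lowPart n A) := fun i a ha => by
  have : a = 0 := by
    rw [← Finsupp.degree_eq_zero_iff]
    omega
  subst this
  simp only [lowPart, PowerSeries.coeff_mk]
  split_ifs <;> simp

/-- The data producing the Weierstrass factorisation of the generic series. -/
structure GenericFactorization (f : ℕ → A) where
  invHigh : PowerSeries (MvPowerSeries (Fin n) A)
  high_mul_invHigh : highPart n f * invHigh = 1
  quot : PowerSeries (MvPowerSeries (Fin n) A)
  quot_eq : quot + dropLow n (quot * (invHigh * lowPart n A)) = 1
  invQuot : PowerSeries (MvPowerSeries (Fin n) A)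
  quot_mul_invQuot : quot * invQuot = 1

namespace GenericFactorization

/-- The high part is invertible because its constant term `f n` is a unit. The Neumann series then
supplies `quot`, which is congruent to `1` modulo the variables and hence invertible. -/
theorem nonempty (f : ℕ → A) (hf : IsUnit (f n)) : Nonempty (GenericFactorization n f) := by
  have hV : IsUnit (highPart n f) := by
    rw [PowerSeries.isUnit_iff_constantCoeff, ← PowerSeries.coeff_zero_eq_constantCoeff_apply]
    simpa [highPart] using hf.map (MvPowerSeries.C (σ := Fin n))
  obtain ⟨V', hV'⟩ := hV.exists_right_inv
  have hB : OrderGE 1 (V' * lowPart n A) := by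
    have h := OrderGE.mul (d := 0) (S := V') (fun i a ha => by omega) (orderGE_lowPart (A := A) n)
    rwa [zero_add] at h
  obtain ⟨W, hW⟩ := exists_add_dropLow_mul_eq_one n _ hB
  have hWu : IsUnit W := by
    rw [PowerSeries.isUnit_iff_constantCoeff, ← PowerSeries.coeff_zero_eq_constantCoeff_apply,
      MvPowerSeries.isUnit_iff_constantCoeff, ← MvPowerSeries.coeff_zero_eq_constantCoeff_apply]
    have h0 : OrderGE 0 W := fun i a ha => by omega
    have h1 : OrderGE 1 (dropLow n (W * (V' * lowPart n A))) := by
      simpa using (h0.mul hB).dropLow n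
    have h2 : W = 1 - dropLow n (W * (V' * lowPart n A)) := by linear_combination hW
    rw [h2, map_sub, map_sub, h1 0 0 (by simp)]
    simp
  obtain ⟨W', hW'⟩ := hWu.exists_right_inv
  exact ⟨⟨V', hV', W, hW, W', hW'⟩⟩

variable {n} {f : ℕ → A} (d : GenericFactorization n f)

/-- The distinguished factor. -/
def poly : PowerSeries (MvPowerSeries (Fin n) A) := d.invHigh * d.quot * genericSeries n f

/-- The unit factor. -/
def unit : PowerSeries (MvPowerSeries (Fin n) A) := highPart n f * d.invQuot

theorem poly_mul_unit : d.poly * d.unit = genericSeries n f := by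
  rw [poly, unit]
  linear_combination (genericSeries n f) * d.high_mul_invHigh * d.quot * d.invQuot +
    (genericSeries n f) * d.quot_mul_invQuot

/-- After multiplication by `invHigh` the generic series becomes `X ^ n + invHigh * lowPart`.
Removing the first `n` coefficients of its product with `quot` leaves the left side of `quot_eq`,
which says that the distinguished factor is a monic polynomial of degree `n`. -/
theorem coeff_poly_add (i : ℕ) :
    PowerSeries.coeff (i + n) d.poly = if i = 0 then 1 else 0 := by
  have h : d.poly = d.quot * (d.invHigh * lowPart n A) + d.quot * PowerSeries.X ^ n := by
    rw [poly, genericSeries]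
    linear_combination (d.quot * PowerSeries.X ^ n) * d.high_mul_invHigh
  rw [h, map_add, PowerSeries.coeff_mul_X_pow, ← coeff_dropLow, ← map_add, add_comm, d.quot_eq,
    PowerSeries.coeff_one]

variable {B : Type*} [CommRing B] (φ : A →+* B)

theorem map_lowPart : PowerSeries.map (MvPowerSeries.map φ) (lowPart n A) = lowPart n B := by
  ext1 i
  simp only [lowPart, PowerSeries.coeff_map, PowerSeries.coeff_mk]
  split_ifs <;> simp

theorem map_highPart :
    PowerSeries.map (MvPowerSeries.map φ) (highPart n f) = highPart n (φ ∘ f) := by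
  ext1 i
  simp [highPart]

theorem map_genericSeries :
    PowerSeries.map (MvPowerSeries.map φ) (genericSeries n f) = genericSeries n (φ ∘ f) := by
  simp [genericSeries, map_lowPart, map_highPart]

/-- Base change of a generic factorisation. -/
def map : GenericFactorization n (φ ∘ f) where
  invHigh := PowerSeries.map (MvPowerSeries.map φ) d.invHigh
  high_mul_invHigh := by rw [← map_highPart, ← map_mul, d.high_mul_invHigh, map_one]
  quot := PowerSeries.map (MvPowerSeries.map φ) d.quot
  quot_eq := by
    rw [← map_lowPart φ, ← map_mul, ← map_mul, ← map_dropLow, ← map_add, d.quot_eq, map_one]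
  invQuot := PowerSeries.map (MvPowerSeries.map φ) d.invQuot
  quot_mul_invQuot := by rw [← map_mul, d.quot_mul_invQuot, map_one]

/-- Compatibility with base change is what allows one factorisation over the universal ring to serve
every `F` and `G`. -/
theorem map_poly : (d.map φ).poly = PowerSeries.map (MvPowerSeries.map φ) d.poly := by
  simp [poly, map, map_genericSeries]

/-- The companion matrix of the distinguished factor. -/
def compMatrix : Matrix (Fin n) (Fin n) (MvPowerSeries (Fin n) A) :=
  companion fun i => PowerSeries.coeff (i : ℕ) d.poly

theorem map_compMatrix : (d.map φ).compMatrix = d.compMatrix.map (MvPowerSeries.map φ) := by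
  simp [compMatrix, map_poly, companion_map]

end GenericFactorization

end FormalFactorization

/-! ### Weights, gauges and coefficient bounds -/

section Weights

variable {n : ℕ}

/-- The weight of a monomial, the variable of index `i` having weight `n - i`. -/
def wt (a : Fin n →₀ ℕ) : ℕ := ∑ i, a i * (n - i)

@[simp] theorem wt_zero : wt (0 : Fin n →₀ ℕ) = 0 := by simp [wt]

theorem wt_add (a b : Fin n →₀ ℕ) : wt (a + b) = wt a + wt b := by
  simp [wt, add_mul, Finset.sum_add_distrib]

theorem wt_single (i : Fin n) : wt (Finsupp.single i 1) = n - i := by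
  rw [wt, Finset.sum_eq_single i]
  · simp
  · intro j _ hj
    simp [Finsupp.single_eq_of_ne hj]
  · simp

theorem degree_le_wt (a : Fin n →₀ ℕ) : a.degree ≤ wt a := by
  rw [Finsupp.degree_eq_sum, wt]
  refine Finset.sum_le_sum fun i _ => Nat.le_mul_of_pos_right _ ?_
  have := i.2
  omega

/-- A gauge for the decay of coefficients with the weight: it vanishes in negative weights, and it is
decreasing and supermultiplicative in nonnegative ones. -/
structure IsGauge (ω : ℤ → ℝ) : Prop where
  eq_zero : ∀ w < 0, ω w = 0
  zero_eq : ω 0 = 1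
  nonneg : ∀ w, 0 ≤ ω w
  anti : ∀ v w, 0 ≤ v → v ≤ w → ω w ≤ ω v
  mul_le' : ∀ v w, 0 ≤ v → 0 ≤ w → ω v * ω w ≤ ω (v + w)

theorem IsGauge.mul_le {ω : ℤ → ℝ} (h : IsGauge ω) (v w : ℤ) : ω v * ω w ≤ ω (v + w) := by
  rcases lt_or_ge v 0 with hv | hv
  · rw [h.eq_zero v hv, zero_mul]
    exact h.nonneg _
  rcases lt_or_ge w 0 with hw | hw
  · rw [h.eq_zero w hw, mul_zero]
    exact h.nonneg _
  exact h.mul_le' v w hv hw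

theorem IsGauge.le_one {ω : ℤ → ℝ} (h : IsGauge ω) (w : ℤ) : ω w ≤ 1 := by
  rcases lt_or_ge w 0 with hw | hw
  · rw [h.eq_zero w hw]
    exact zero_le_one
  · rw [← h.zero_eq]
    exact h.anti 0 w le_rfl hw

variable {K : Type*} [NormedField K] [IsUltrametricDist K]

/-- The coefficient of each monomial `a` of `Ψ` is bounded by the gauge at `wt a + d`. -/
def WeightBounded (ω : ℤ → ℝ) (d : ℤ) (Ψ : MvPowerSeries (Fin n) K) : Prop :=
  ∀ a, ‖MvPowerSeries.coeff a Ψ‖ ≤ ω (wt a + d)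

/-- The coefficient of index `i` of `S` is bounded with shift `i + d`. -/
def SeriesBounded (ω : ℤ → ℝ) (d : ℤ) (S : PowerSeries (MvPowerSeries (Fin n) K)) : Prop :=
  ∀ i : ℕ, WeightBounded ω (i + d) (PowerSeries.coeff i S)

variable {ω : ℤ → ℝ} (hω : IsGauge ω)
include hω

theorem WeightBounded.zero (d : ℤ) : WeightBounded ω d (0 : MvPowerSeries (Fin n) K) := fun a => by
  simpa using hω.nonneg _

theorem WeightBounded.C {d : ℤ} {c : K} (hc : ‖c‖ ≤ ω d) :
    WeightBounded ω d (MvPowerSeries.C c : MvPowerSeries (Fin n) K) := fun a => by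
  classical
  rw [MvPowerSeries.coeff_C]
  split_ifs with h
  · simpa [h] using hc
  · simpa using hω.nonneg _

theorem WeightBounded.one : WeightBounded ω 0 (1 : MvPowerSeries (Fin n) K) := by
  simpa using WeightBounded.C (n := n) hω (d := 0) (c := (1 : K)) (by simp [hω.zero_eq])

/-- The shift `i - n` exactly cancels the weight of the variable, so the bound required is `ω 0 =
1`. -/
theorem WeightBounded.X (i : Fin n) :
    WeightBounded ω (i - n) (MvPowerSeries.X i : MvPowerSeries (Fin n) K) := fun a => by
  classical
  rw [MvPowerSeries.coeff_X]
  split_ifs with h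
  · have : ((n - (i : ℕ) : ℕ) : ℤ) + ((i : ℤ) - n) = 0 := by
      have := i.2
      omega
    rw [h, wt_single, this, hω.zero_eq, norm_one]
  · simpa using hω.nonneg _

omit hω in
theorem WeightBounded.neg {d : ℤ} {Ψ : MvPowerSeries (Fin n) K} (h : WeightBounded ω d Ψ) :
    WeightBounded ω d (-Ψ) := fun a => by
  simpa using h a

theorem WeightBounded.sum {ι : Type*} {s : Finset ι} {d : ℤ} {Ψ : ι → MvPowerSeries (Fin n) K}
    (h : ∀ i ∈ s, WeightBounded ω d (Ψ i)) : WeightBounded ω d (∑ i ∈ s, Ψ i) := fun a => by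
  rw [map_sum]
  exact IsUltrametricDist.norm_sum_le_of_forall_le_of_nonneg (hω.nonneg _) fun i hi => h i hi a

/-- Weights add when monomials are multiplied. The ultrametric inequality reduces to a single
product of coefficients, where `ω v * ω w ≤ ω (v + w)` applies. -/
theorem WeightBounded.mul {d e : ℤ} {Ψ Θ : MvPowerSeries (Fin n) K}
    (h : WeightBounded ω d Ψ) (h' : WeightBounded ω e Θ) :
    WeightBounded ω (d + e) (Ψ * Θ) := fun a => by
  classical
  rw [MvPowerSeries.coeff_mul]
  refine IsUltrametricDist.norm_sum_le_of_forall_le_of_nonneg (hω.nonneg _) fun x hx => ?_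
  rw [norm_mul, ← mem_antidiagonal.mp hx, wt_add]
  refine (mul_le_mul (h _) (h' _) (norm_nonneg _) (hω.nonneg _)).trans ((hω.mul_le _ _).trans ?_)
  apply le_of_eq
  congr 1
  push_cast
  ring

theorem SeriesBounded.mul {d e : ℤ} {S T : PowerSeries (MvPowerSeries (Fin n) K)}
    (h : SeriesBounded ω d S) (h' : SeriesBounded ω e T) :
    SeriesBounded ω (d + e) (S * T) := fun i => by
  rw [PowerSeries.coeff_mul]
  refine WeightBounded.sum hω fun x hx => ?_
  have h1 := (h x.1).mul hω (h' x.2)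
  have h2 : (x.1 : ℤ) + d + (x.2 + e) = i + (d + e) := by
    rw [← mem_antidiagonal.mp hx]
    push_cast
    ring
  rwa [h2] at h1

omit hω in
theorem SeriesBounded.dropLow {d : ℤ} {S : PowerSeries (MvPowerSeries (Fin n) K)}
    (h : SeriesBounded ω d S) (m : ℕ) : SeriesBounded ω (d + m) (dropLow m S) := fun i => by
  rw [coeff_dropLow]
  have h1 := h (i + m)
  have h2 : ((i + m : ℕ) : ℤ) + d = i + (d + m) := by
    push_cast
    ring
  rwa [h2] at h1

/-- The coefficient equation of `S * T = 1` expresses a coefficient of `T`, times a leading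
coefficient of norm `1`, through those with smaller `i + a.degree`. The induction is on that total.
-/
theorem SeriesBounded.of_mul_eq_one {S T : PowerSeries (MvPowerSeries (Fin n) K)}
    (h : SeriesBounded ω 0 S) (hST : S * T = 1)
    (h1 : ‖MvPowerSeries.coeff 0 (PowerSeries.coeff 0 S)‖ = 1) : SeriesBounded ω 0 T := by
  classical
  suffices H : ∀ (N i : ℕ) (a : Fin n →₀ ℕ), i + a.degree = N →
      ‖MvPowerSeries.coeff a (PowerSeries.coeff i T)‖ ≤ ω (wt a + (i + 0)) from
    fun i a => H _ i a rfl
  intro N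
  induction N using Nat.strong_induction_on with
  | _ N ih =>
    intro i a hN
    have h2 : MvPowerSeries.coeff a (PowerSeries.coeff i (S * T)) =
        ∑ x ∈ antidiagonal i ×ˢ antidiagonal a,
          MvPowerSeries.coeff x.2.1 (PowerSeries.coeff x.1.1 S) *
            MvPowerSeries.coeff x.2.2 (PowerSeries.coeff x.1.2 T) := by
      rw [PowerSeries.coeff_mul, map_sum, Finset.sum_product]
      refine Finset.sum_congr rfl fun x _ => ?_
      rw [MvPowerSeries.coeff_mul]
    have hmem : (((0, i), (0, a)) : (ℕ × ℕ) × ((Fin n →₀ ℕ) × (Fin n →₀ ℕ))) ∈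
        antidiagonal i ×ˢ antidiagonal a := by
      simp
    rw [hST, ← Finset.add_sum_erase _ _ hmem] at h2
    have h3 : ‖MvPowerSeries.coeff a (PowerSeries.coeff i
        (1 : PowerSeries (MvPowerSeries (Fin n) K)))‖ ≤ ω (wt a + (i + 0)) := by
      rw [PowerSeries.coeff_one]
      split_ifs with hi
      · simpa [hi] using WeightBounded.one (K := K) hω a
      · simpa using hω.nonneg _
    have h4 : ∀ x ∈ (antidiagonal i ×ˢ antidiagonal a).erase ((0, i), (0, a)),
        ‖MvPowerSeries.coeff x.2.1 (PowerSeries.coeff x.1.1 S) *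
            MvPowerSeries.coeff x.2.2 (PowerSeries.coeff x.1.2 T)‖ ≤ ω (wt a + (i + 0)) := by
      rintro ⟨⟨j, l⟩, ⟨b, c⟩⟩ hx
      simp only [Finset.mem_erase, Finset.mem_product, HasAntidiagonal.mem_antidiagonal] at hx
      obtain ⟨hne, hjl, hbc⟩ := hx
      have hdeg : b.degree + c.degree = a.degree := by rw [← hbc, map_add]
      have hlt : l + c.degree < N := by
        by_contra hcon
        have hj : j = 0 := by omega
        have hb : b = 0 := by
          rw [← Finsupp.degree_eq_zero_iff]
          omega
        subst hj hb
        apply hne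
        simp at hjl hbc
        rw [hjl, hbc]
      rw [norm_mul]
      refine (mul_le_mul (h j b) (ih _ hlt l c rfl) (norm_nonneg _) (hω.nonneg _)).trans
        ((hω.mul_le _ _).trans (le_of_eq ?_))
      rw [← hbc, ← hjl, wt_add]
      congr 1
      push_cast
      ring
    have h5 : MvPowerSeries.coeff 0 (PowerSeries.coeff 0 S) *
        MvPowerSeries.coeff a (PowerSeries.coeff i T) =
        MvPowerSeries.coeff a (PowerSeries.coeff i (1 : PowerSeries (MvPowerSeries (Fin n) K))) -
        ∑ x ∈ (antidiagonal i ×ˢ antidiagonal a).erase ((0, i), (0, a)),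
          MvPowerSeries.coeff x.2.1 (PowerSeries.coeff x.1.1 S) *
            MvPowerSeries.coeff x.2.2 (PowerSeries.coeff x.1.2 T) := by
      rw [h2]
      ring
    have h6 := congrArg norm h5
    rw [norm_mul, h1, one_mul] at h6
    rw [h6]
    exact (norm_sub_le_max _ _).trans (max_le h3
      (IsUltrametricDist.norm_sum_le_of_forall_le_of_nonneg (hω.nonneg _) h4))

/-- The index in `X` may increase in the recursion, so the induction is on `a.degree` alone: it
drops strictly because `B` has order at least `1`. The shift `-n` of `B` cancels the shift `n`
caused by `dropLow`. -/
theorem SeriesBounded.of_add_dropLow_mul_eq_one {W B : PowerSeries (MvPowerSeries (Fin n) K)}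
    (hB : SeriesBounded ω (-n) B) (hB1 : OrderGE 1 B) (hW : W + PadicResultant.dropLow n (W * B) = 1) :
    SeriesBounded ω 0 W := by
  classical
  suffices H : ∀ (N i : ℕ) (a : Fin n →₀ ℕ), a.degree = N →
      ‖MvPowerSeries.coeff a (PowerSeries.coeff i W)‖ ≤ ω (wt a + (i + 0)) from
    fun i a => H _ i a rfl
  intro N
  induction N using Nat.strong_induction_on with
  | _ N ih =>
    intro i a hN
    have hW' : W = 1 - PadicResultant.dropLow n (W * B) := by linear_combination hW
    rw [hW', map_sub, map_sub, coeff_dropLow]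
    refine (norm_sub_le_max _ _).trans (max_le ?_ ?_)
    · rw [PowerSeries.coeff_one]
      split_ifs with hi
      · simpa [hi] using WeightBounded.one (K := K) hω a
      · simpa using hω.nonneg _
    · rw [PowerSeries.coeff_mul, map_sum]
      refine IsUltrametricDist.norm_sum_le_of_forall_le_of_nonneg (hω.nonneg _) fun x hx => ?_
      rw [MvPowerSeries.coeff_mul]
      refine IsUltrametricDist.norm_sum_le_of_forall_le_of_nonneg (hω.nonneg _) fun y hy => ?_
      have hx' := mem_antidiagonal.mp hx
      have hy' := mem_antidiagonal.mp hy
      have hdeg : y.1.degree + y.2.degree = a.degree := by rw [← hy', map_add]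
      rcases Nat.eq_zero_or_pos y.2.degree with h0 | h0
      · rw [hB1 x.2 y.2 (by omega), mul_zero, norm_zero]
        exact hω.nonneg _
      · rw [norm_mul]
        refine (mul_le_mul (ih _ (by omega) x.1 y.1 rfl) (hB x.2 y.2) (norm_nonneg _)
          (hω.nonneg _)).trans ((hω.mul_le _ _).trans (le_of_eq ?_))
        rw [← hy', wt_add]
        congr 1
        have : (x.1 : ℤ) + x.2 = i + n := by exact_mod_cast hx'
        push_cast
        linear_combination this

namespace GenericFactorization

variable {f : ℕ → K} (d : GenericFactorization n f) (hf1 : ‖f n‖ = 1)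
  (hf : ∀ k : ℕ, ‖f (n + k)‖ ≤ ω k)
include hf

theorem seriesBounded_highPart : SeriesBounded ω 0 (highPart n f) := fun i => by
  rw [highPart, PowerSeries.coeff_mk, add_zero]
  exact WeightBounded.C hω (hf i)

omit hf in
theorem seriesBounded_lowPart : SeriesBounded ω (-n) (lowPart n K) := fun i => by
  rw [lowPart, PowerSeries.coeff_mk]
  split_ifs with h
  · exact WeightBounded.X hω ⟨i, h⟩
  · exact WeightBounded.zero hω _

include hf1

theorem seriesBounded_invHigh : SeriesBounded ω 0 d.invHigh :=
  (seriesBounded_highPart hω hf).of_mul_eq_one hω d.high_mul_invHigh (by simpa [highPart] using hf1)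

theorem seriesBounded_quot : SeriesBounded ω 0 d.quot := by
  refine SeriesBounded.of_add_dropLow_mul_eq_one hω ?_ ?_ d.quot_eq
  · have h := (d.seriesBounded_invHigh hω hf1 hf).mul hω (seriesBounded_lowPart (K := K) (n := n) hω)
    rwa [zero_add] at h
  · have h := OrderGE.mul (d := 0) (S := d.invHigh) (fun i a ha => by omega)
      (orderGE_lowPart (A := K) n)
    rwa [zero_add] at h

theorem seriesBounded_unit : SeriesBounded ω 0 d.unit := by
  have h0 : MvPowerSeries.coeff 0 (PowerSeries.coeff 0 d.quot) = 1 := by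
    have h2 : OrderGE 1 (d.quot * (d.invHigh * lowPart n K)) := by
      have h := OrderGE.mul (d := 0) (S := d.quot * d.invHigh) (fun i a ha => by omega)
        (orderGE_lowPart (A := K) n)
      rwa [zero_add, mul_assoc] at h
    have h3 : d.quot = 1 - dropLow n (d.quot * (d.invHigh * lowPart n K)) := by
      linear_combination d.quot_eq
    rw [h3, map_sub, map_sub, (h2.dropLow n) 0 0 (by simp)]
    simp
  have h := (seriesBounded_highPart hω hf).mul hω
    ((d.seriesBounded_quot hω hf1 hf).of_mul_eq_one hω d.quot_mul_invQuot (by rw [h0, norm_one]))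
  rwa [zero_add] at h

theorem seriesBounded_poly : SeriesBounded ω (-n) d.poly := by
  have hF : SeriesBounded ω (-n) (genericSeries n f) := fun i => by
    rw [coeff_genericSeries]
    split_ifs with h
    · exact WeightBounded.X hω ⟨i, h⟩
    · refine WeightBounded.C hω ?_
      have h1 := hf (i - n)
      rw [Nat.add_sub_cancel' (not_lt.mp h)] at h1
      have h2 : ((i - n : ℕ) : ℤ) = i + -n := by omega
      rwa [h2] at h1
  have h := ((d.seriesBounded_invHigh hω hf1 hf).mul hω (d.seriesBounded_quot hω hf1 hf)).mul hω hF
  rwa [zero_add, zero_add] at h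

/-- A single companion matrix has shift `i - j - 1`: this is `0` on the subdiagonal, and `i - n` in
the last column, matching the bound for the distinguished factor. Each further power lowers the
shift by one, so a fixed coefficient vanishes for all large `k`. -/
theorem weightBounded_compMatrix_pow (k : ℕ) (i j : Fin n) :
    WeightBounded ω (i - j - k) ((d.compMatrix ^ k) i j) := by
  induction k generalizing i j with
  | zero =>
    rw [pow_zero, Matrix.one_apply]
    split_ifs with h
    · simpa [h] using WeightBounded.one hω
    · exact WeightBounded.zero hω _
  | succ k ih =>
    rw [pow_succ, Matrix.mul_apply]
    refine WeightBounded.sum hω fun l _ => ?_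
    have h1 : WeightBounded ω (l - j - 1) (d.compMatrix l j) := by
      rw [compMatrix, companion, Matrix.of_apply]
      split_ifs with h h'
      · have h2 := (d.seriesBounded_poly hω hf1 hf l).neg
        have h3 : ((l : ℕ) : ℤ) - (j : ℕ) - 1 = (l : ℕ) + -(n : ℤ) := by omega
        rwa [h3]
      · have h3 : ((l : ℕ) : ℤ) - (j : ℕ) - 1 = 0 := by omega
        rw [h3]
        exact WeightBounded.one hω
      · exact WeightBounded.zero hω _
    have h2 := (ih i l).mul hω h1
    have h3 : ((i : ℕ) : ℤ) - (l : ℕ) - k + ((l : ℕ) - (j : ℕ) - 1) =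
        (i : ℕ) - (j : ℕ) - (k + 1 : ℕ) := by
      push_cast
      ring
    rwa [h3] at h2

end GenericFactorization

end Weights

/-! ### The universal resultant and its value at a point -/

namespace GenericFactorization

section Entries

variable {n : ℕ} {A : Type*} [CommRing A] {f : ℕ → A} (d : GenericFactorization n f)

/-- The matrix `∑_k g_k C ^ k`, where `C` is the companion matrix of the distinguished factor. The
sum is cut off, coefficient by coefficient, where its terms vanish. -/
def seriesMatrix (g : ℕ → A) : Matrix (Fin n) (Fin n) (MvPowerSeries (Fin n) A) :=
  Matrix.of fun i j => fun a => ∑ k ∈ range (wt a + n + 1),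
    g k * MvPowerSeries.coeff a ((d.compMatrix ^ k) i j)

theorem coeff_seriesMatrix (g : ℕ → A) (i j : Fin n) (a : Fin n →₀ ℕ) :
    MvPowerSeries.coeff a (d.seriesMatrix g i j) =
      ∑ k ∈ range (wt a + n + 1), g k * MvPowerSeries.coeff a ((d.compMatrix ^ k) i j) := rfl

/-- The universal resultant. -/
def resultantSeries (g : ℕ → A) (N : ℕ) : MvPowerSeries (Fin n) A :=
  MvPowerSeries.C (f n) ^ N * (d.seriesMatrix g).det

variable {B : Type*} [CommRing B] (φ : A →+* B)

/-- The cut-off depends only on the exponent and on `n`, so each coefficient is a finite sum and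
commutes with any ring homomorphism, with no topology involved. -/
theorem map_seriesMatrix (g : ℕ → A) :
    (d.map φ).seriesMatrix (φ ∘ g) = (d.seriesMatrix g).map (MvPowerSeries.map φ) := by
  have h : ∀ k i j, ((d.map φ).compMatrix ^ k) i j =
      MvPowerSeries.map φ ((d.compMatrix ^ k) i j) := fun k i j => by
    rw [map_compMatrix]
    change ((RingHom.mapMatrix (MvPowerSeries.map φ) d.compMatrix) ^ k) i j = _
    rw [← map_pow]
    rfl
  ext i j a
  simp only [coeff_seriesMatrix, Matrix.map_apply, MvPowerSeries.coeff_map, h, map_sum, map_mul,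
    Function.comp_apply]

theorem map_resultantSeries (g : ℕ → A) (N : ℕ) :
    (d.map φ).resultantSeries (φ ∘ g) N = MvPowerSeries.map φ (d.resultantSeries g N) := by
  rw [resultantSeries, resultantSeries, map_seriesMatrix, map_mul, map_pow, RingHom.map_det]
  simp

end Entries

section Value

variable {K : Type*} [NormedField K] [IsUltrametricDist K] [CompleteSpace K] {n : ℕ}

/-- At the point `x` the monomials compensate the growth allowed by the gauge. -/
structure IsTame (ω : ℤ → ℝ) (x : Fin n → K) : Prop where
  norm_le_one : ∀ i, ‖x i‖ ≤ 1
  tendsto : ∀ e : ℤ, Tendsto (fun a : Fin n →₀ ℕ => ω (wt a + e) * ‖monomialValue x a‖)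
    cofinite (𝓝 0)

variable {ω : ℤ → ℝ} (hω : IsGauge ω) {x : Fin n → K} (hx : IsTame ω x)

omit [CompleteSpace K] in
include hx in
theorem norm_monomialValue_le_one (a : Fin n →₀ ℕ) : ‖monomialValue x a‖ ≤ 1 := by
  simpa using norm_monomialValue_le_pow hx.norm_le_one a

include hx in
theorem convergesAt_of_weightBounded {e : ℤ} {Ψ : MvPowerSeries (Fin n) K}
    (h : WeightBounded ω e Ψ) : ConvergesAt x Ψ :=
  summable_of_norm_le_of_tendsto (hx.tendsto e) fun a => by
    rw [norm_mul]
    gcongr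
    exact h a

variable {f : ℕ → K} (d : GenericFactorization n f) (hf1 : ‖f n‖ = 1)
  (hf : ∀ k : ℕ, ‖f (n + k)‖ ≤ ω k)

variable (x) in
/-- The value at `x` of the distinguished factor. -/
def evalPoly : Polynomial K :=
  PowerSeries.trunc (n + 1) (PowerSeries.mk fun i => mvEval x (PowerSeries.coeff i d.poly))

variable (x) in
/-- The value at `x` of the unit factor. -/
def evalUnit : PowerSeries K := PowerSeries.mk fun i => mvEval x (PowerSeries.coeff i d.unit)

omit [CompleteSpace K] in
theorem mvEval_coeff_poly_add (i : ℕ) :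
    mvEval x (PowerSeries.coeff (i + n) d.poly) = if i = 0 then 1 else 0 := by
  rw [d.coeff_poly_add]
  split_ifs with h
  · simpa using mvEval_C x (1 : K)
  · simp [mvEval]

omit [CompleteSpace K] in
theorem coeff_evalPoly (i : ℕ) :
    (d.evalPoly x).coeff i = mvEval x (PowerSeries.coeff i d.poly) := by
  rw [evalPoly, PowerSeries.coeff_trunc, PowerSeries.coeff_mk]
  split_ifs with h
  · rfl
  · have h1 := d.mvEval_coeff_poly_add (x := x) (i - n)
    rw [Nat.sub_add_cancel (by omega), if_neg (by omega)] at h1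
    exact h1.symm

omit [CompleteSpace K] in
theorem natDegree_evalPoly : (d.evalPoly x).natDegree = n := by
  refine Polynomial.natDegree_eq_of_le_of_coeff_ne_zero ?_ ?_
  · rw [Polynomial.natDegree_le_iff_coeff_eq_zero]
    intro i hi
    have h1 := d.mvEval_coeff_poly_add (x := x) (i - n)
    rw [Nat.sub_add_cancel (by omega), if_neg (by omega)] at h1
    rw [coeff_evalPoly, h1]
  · have h1 := d.mvEval_coeff_poly_add (x := x) 0
    rw [zero_add, if_pos rfl] at h1
    rw [coeff_evalPoly, h1]
    exact one_ne_zero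

omit [CompleteSpace K] in
theorem monic_evalPoly : (d.evalPoly x).Monic := by
  have h1 := d.mvEval_coeff_poly_add (x := x) 0
  rw [zero_add, if_pos rfl] at h1
  rw [Polynomial.Monic, Polynomial.leadingCoeff, natDegree_evalPoly, coeff_evalPoly, h1]

include hω hx hf1 hf

/-- Each coefficient of the formal identity `poly * unit = genericSeries` is an identity between
finitely many convergent series, and evaluation is a ring homomorphism on these. -/
theorem evalPoly_mul_evalUnit :
    (d.evalPoly x : PowerSeries K) * d.evalUnit x =
      PowerSeries.mk fun i => if h : i < n then x ⟨i, h⟩ else f i := by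
  let P : ℕ → convergentSubring x := fun i => ⟨PowerSeries.coeff i d.poly,
    convergesAt_of_weightBounded hx (d.seriesBounded_poly hω hf1 hf i)⟩
  let U : ℕ → convergentSubring x := fun i => ⟨PowerSeries.coeff i d.unit,
    convergesAt_of_weightBounded hx (d.seriesBounded_unit hω hf1 hf i)⟩
  ext i
  have h1 : ((∑ y ∈ antidiagonal i, P y.1 * U y.2 : convergentSubring x) :
      MvPowerSeries (Fin n) K) = PowerSeries.coeff i (genericSeries n f) := by
    rw [← d.poly_mul_unit, PowerSeries.coeff_mul]
    simp [P, U]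
  have h2 := congrArg (mvEval x) h1
  rw [← mvEvalHom_apply, map_sum] at h2
  rw [PowerSeries.coeff_mul, PowerSeries.coeff_mk]
  have h3 : mvEval x (PowerSeries.coeff i (genericSeries n f)) =
      if h : i < n then x ⟨i, h⟩ else f i := by
    rw [coeff_genericSeries]
    split_ifs with h
    · exact mvEval_X x _
    · exact mvEval_C x _
  rw [← h3, ← h2]
  refine Finset.sum_congr rfl fun y _ => ?_
  rw [map_mul, Polynomial.coeff_coe, coeff_evalPoly, evalUnit, PowerSeries.coeff_mk]
  rfl

theorem norm_coeff_evalUnit_le (k : ℕ) : ‖PowerSeries.coeff k (d.evalUnit x)‖ ≤ ω k := by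
  rw [evalUnit, PowerSeries.coeff_mk]
  refine norm_mvEval_le (hω.nonneg _) fun a => ?_
  refine (mul_le_of_le_one_right (norm_nonneg _) (norm_monomialValue_le_one hx a)).trans
    ((d.seriesBounded_unit hω hf1 hf k a).trans ?_)
  exact hω.anti _ _ (by omega) (by omega)

/-- The term with `a = 0` vanishes because its weight `i - n` is negative. Every other monomial
contains at least one variable, hence has norm at most `r`. -/
theorem norm_coeff_evalPoly_le {r : ℝ} (hr0 : 0 ≤ r) (hr1 : r ≤ 1) (hr : ∀ i, ‖x i‖ ≤ r) {i : ℕ}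
    (hi : i < n) : ‖(d.evalPoly x).coeff i‖ ≤ r := by
  rw [coeff_evalPoly]
  refine norm_mvEval_le hr0 fun a => ?_
  have h := d.seriesBounded_poly hω hf1 hf i a
  rcases eq_or_ne a 0 with rfl | ha
  · rw [hω.eq_zero _ (by rw [wt_zero]; omega)] at h
    rw [le_antisymm h (norm_nonneg _), zero_mul]
    exact hr0
  · refine (mul_le_of_le_one_left (norm_nonneg _) (h.trans (hω.le_one _))).trans
      ((norm_monomialValue_le_pow hr a).trans (pow_le_of_le_one hr0 hr1 ?_))
    rwa [ne_eq, Finsupp.degree_eq_zero_iff]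

/-- The companion matrix of the distinguished factor, over the subring of convergent series. -/
def convergentCompMatrix : Matrix (Fin n) (Fin n) (convergentSubring x) :=
  companion fun i => ⟨PowerSeries.coeff (i : ℕ) d.poly,
    convergesAt_of_weightBounded hx (d.seriesBounded_poly hω hf1 hf i)⟩

theorem mvEval_compMatrix_pow (k : ℕ) (i j : Fin n) :
    mvEval x ((d.compMatrix ^ k) i j) =
      ((companion fun l : Fin n => (d.evalPoly x).coeff l) ^ k) i j := by
  have h1 : (convergentSubring x).subtype.mapMatrix
      (d.convergentCompMatrix hω hx hf1 hf) = d.compMatrix := by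
    rw [RingHom.mapMatrix_apply, convergentCompMatrix, companion_map]
    rfl
  have h2 : (mvEvalHom x).mapMatrix (d.convergentCompMatrix hω hx hf1 hf) =
      companion fun l : Fin n => (d.evalPoly x).coeff l := by
    rw [RingHom.mapMatrix_apply, convergentCompMatrix, companion_map]
    simp only [coeff_evalPoly, mvEvalHom_apply]
  rw [← h1, ← h2, ← map_pow, ← map_pow]
  rfl

variable {g : ℕ → K} {c : ℝ} (hg : ∀ k : ℕ, ‖g k‖ ≤ c * ω k)
include hg

/-- The double family `t` over `(k, a)` is summed in two ways: `a` first gives `g` at the evaluated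
companion matrix, `k` first gives the value of the formal entry. It is summable because its bound
does not depend on `k` and tends to `0` in `a`, while each `a` admits only finitely many nonzero
`k`. -/
theorem hasSum_seriesMatrix (i j : Fin n) :
    ConvergesAt x (d.seriesMatrix g i j) ∧
    HasSum (fun k => g k * ((companion fun l : Fin n => (d.evalPoly x).coeff l) ^ k) i j)
      (mvEval x (d.seriesMatrix g i j)) := by
  have hc : 0 ≤ c := by
    have h := (norm_nonneg _).trans (hg 0)
    simpa [hω.zero_eq] using h
  let t : ℕ × (Fin n →₀ ℕ) → K := fun y =>
    g y.1 * (MvPowerSeries.coeff y.2 ((d.compMatrix ^ y.1) i j) * monomialValue x y.2)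
  have hC : ∀ k : ℕ, WeightBounded ω (i - j - k) ((d.compMatrix ^ k) i j) := fun k =>
    d.weightBounded_compMatrix_pow hω hf1 hf k i j
  -- For these `k` the argument of the gauge is negative, so the bound forces exact vanishing. This
  -- justifies the cut-off in `seriesMatrix`.
  have ht0 : ∀ (k : ℕ) (a : Fin n →₀ ℕ), wt a + n < k →
      MvPowerSeries.coeff a ((d.compMatrix ^ k) i j) = 0 := fun k a hk => by
    have h := hC k a
    rw [hω.eq_zero _ (by have := i.2; omega)] at h
    exact norm_le_zero_iff.mp h
  have htle : ∀ k a, ‖t (k, a)‖ ≤ c * (ω (wt a + (i - j)) * ‖monomialValue x a‖) := fun k a => by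
    simp only [t, norm_mul]
    have h1 := mul_le_mul (hg k) (hC k a) (norm_nonneg _) ((norm_nonneg _).trans (hg k))
    have h2 := hω.mul_le k (wt a + (i - j - k))
    have h3 : (k : ℤ) + (wt a + ((i : ℕ) - (j : ℕ) - k)) = wt a + ((i : ℕ) - (j : ℕ)) := by ring
    rw [h3] at h2
    calc ‖g k‖ * (‖MvPowerSeries.coeff a ((d.compMatrix ^ k) i j)‖ * ‖monomialValue x a‖)
        = (‖g k‖ * ‖MvPowerSeries.coeff a ((d.compMatrix ^ k) i j)‖) * ‖monomialValue x a‖ := by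
          ring
      _ ≤ (c * ω k * ω (wt a + (i - j - k))) * ‖monomialValue x a‖ :=
          mul_le_mul_of_nonneg_right h1 (norm_nonneg _)
      _ = c * ((ω k * ω (wt a + (i - j - k))) * ‖monomialValue x a‖) := by ring
      _ ≤ _ := by gcongr
  have hts : Summable t := by
    refine NonarchimedeanAddGroup.summable_of_tendsto_cofinite_zero ?_
    rw [NormedAddGroup.tendsto_nhds_zero]
    intro ε hε
    have h1 := (hx.tendsto (i - j)).const_mul c
    rw [mul_zero] at h1
    have h2 := h1.eventually (gt_mem_nhds hε)
    rw [eventually_cofinite] at h2 ⊢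
    refine (h2.biUnion fun a _ => ((Set.finite_le_nat (wt a + n)).prod
      (Set.finite_singleton a))).subset ?_
    rintro ⟨k, a⟩ hka
    simp only [Set.mem_ofPred_eq, not_lt] at hka
    simp only [Set.mem_iUnion, Set.mem_prod, Set.mem_ofPred_eq, Set.mem_singleton_iff, not_lt]
    refine ⟨a, hka.trans (htle k a), ?_, rfl⟩
    by_contra hk
    simp only [t] at hka
    rw [ht0 k a (by omega), zero_mul, mul_zero, norm_zero] at hka
    exact absurd hka (not_le.mpr hε)
  have hk : HasSum (fun k => g k * mvEval x ((d.compMatrix ^ k) i j)) (∑' y, t y) :=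
    hts.hasSum.prod_fiberwise fun k =>
      (convergesAt_of_weightBounded hx (hC k)).hasSum.mul_left (g k)
  have ha : HasSum (fun a => MvPowerSeries.coeff a (d.seriesMatrix g i j) * monomialValue x a)
      (∑' y, t y) := by
    have hs : HasSum (t ∘ Equiv.prodComm (Fin n →₀ ℕ) ℕ) (∑' y, t y) :=
      (Equiv.hasSum_iff (Equiv.prodComm (Fin n →₀ ℕ) ℕ)).mpr hts.hasSum
    refine hs.prod_fiberwise fun a => ?_
    rw [coeff_seriesMatrix, Finset.sum_mul]
    have h : ∀ k, g k * MvPowerSeries.coeff a ((d.compMatrix ^ k) i j) * monomialValue x a =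
        t (k, a) := fun k => by
      simp only [t]
      ring
    rw [Finset.sum_congr rfl fun k _ => h k]
    refine hasSum_sum_of_ne_finset_zero fun k hk => ?_
    rw [Finset.mem_range, not_lt] at hk
    change t (k, a) = 0
    simp only [t]
    rw [ht0 k a (by omega), zero_mul, mul_zero]
  refine ⟨ha.summable, ?_⟩
  have h1 : mvEval x (d.seriesMatrix g i j) = ∑' y, t y := ha.tsum_eq
  rw [h1]
  simpa only [d.mvEval_compMatrix_pow hω hx hf1 hf] using hk

/-- For the truncations of `g`, which are polynomials, `det_aeval_companion` identifies the
determinant with the product over the roots. Both sides are continuous in the truncation, and limits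
are unique. -/
theorem hasSum_resultantSeries [IsAlgClosed K]
    (hz : ∀ z ∈ (d.evalPoly x).roots, Summable fun k => g k * z ^ k) (N : ℕ) :
    HasSum (fun a => MvPowerSeries.coeff a (d.resultantSeries g N) * monomialValue x a)
      (f n ^ N * ((d.evalPoly x).roots.map fun z => ∑' k, g k * z ^ k).prod) := by
  let M : Matrix (Fin n) (Fin n) (convergentSubring x) := Matrix.of fun i j =>
    ⟨d.seriesMatrix g i j, (d.hasSum_seriesMatrix hω hx hf1 hf hg i j).1⟩
  let c0 : convergentSubring x := ⟨MvPowerSeries.C (f n), (hasSum_mvEval_C x (f n)).summable⟩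
  set D := companion fun l : Fin n => (d.evalPoly x).coeff l with hD
  have hdet : (M.map (mvEvalHom x)).det =
      ((d.evalPoly x).roots.map fun z => ∑' k, g k * z ^ k).prod := by
    have hdetD : ∀ q : Polynomial K, (Polynomial.aeval D q).det =
        ((d.evalPoly x).roots.map fun z => q.eval z).prod := by
      have h := det_aeval_companion (d.monic_evalPoly (x := x))
      have hn := d.natDegree_evalPoly (x := x)
      rw [hD]
      generalize d.evalPoly x = P at h hn
      subst hn
      exact h
    let q : ℕ → Polynomial K := fun m => ∑ k ∈ range m, Polynomial.C (g k) * Polynomial.X ^ k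
    have hq1 : Tendsto (fun m => (Polynomial.aeval D (q m)).det) atTop
        (𝓝 (M.map (mvEvalHom x)).det) := by
      refine ((Continuous.matrix_det continuous_id).tendsto _).comp ?_
      refine tendsto_pi_nhds.mpr fun i => tendsto_pi_nhds.mpr fun j => ?_
      have h := (d.hasSum_seriesMatrix hω hx hf1 hf hg i j).2.tendsto_sum_nat
      refine h.congr fun m => ?_
      simp [q, Matrix.sum_apply, Algebra.algebraMap_eq_smul_one, D]
    have hq2 : Tendsto (fun m => ((d.evalPoly x).roots.map fun z => (q m).eval z).prod) atTop
        (𝓝 ((d.evalPoly x).roots.map fun z => ∑' k, g k * z ^ k).prod) := by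
      refine tendsto_multiset_prod _ fun z hz' => ?_
      refine (hz z hz').hasSum.tendsto_sum_nat.congr fun m => ?_
      simp [q, Polynomial.eval_finsetSum]
    simp only [hdetD] at hq1
    exact tendsto_nhds_unique hq1 hq2
  have h1 : (c0 ^ N * M.det).1 = d.resultantSeries g N := by
    rw [resultantSeries]
    change (convergentSubring x).subtype (c0 ^ N * M.det) = _
    rw [map_mul, map_pow, RingHom.map_det]
    rfl
  have h2 : mvEval x (d.resultantSeries g N) =
      f n ^ N * ((d.evalPoly x).roots.map fun z => ∑' k, g k * z ^ k).prod := by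
    rw [← h1, ← mvEvalHom_apply, map_mul, map_pow, RingHom.map_det, RingHom.mapMatrix_apply, hdet]
    congr 2
    exact mvEval_C x (f n)
  rw [← h2, ← h1]
  exact Summable.hasSum (c0 ^ N * M.det).2

end Value

end GenericFactorization

/-! ### The bounded gauge and the decaying gauge -/

theorem tendsto_degree_cofinite (n : ℕ) :
    Tendsto (fun a : Fin n →₀ ℕ => a.degree) cofinite atTop := by
  rw [tendsto_atTop]
  intro D
  rw [eventually_cofinite]
  refine (Finsupp.finite_of_degree_le D).subset fun a ha => ?_
  simp only [Set.mem_ofPred_eq, not_le] at ha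
  exact ha.le

theorem tendsto_wt_cofinite (n : ℕ) :
    Tendsto (fun a : Fin n →₀ ℕ => wt a) cofinite atTop :=
  tendsto_atTop_mono degree_le_wt (tendsto_degree_cofinite n)

section Gauges

/-- The gauge for bounded coefficients. -/
def boundedGauge (w : ℤ) : ℝ := if w < 0 then 0 else 1

theorem boundedGauge_natCast (k : ℕ) : boundedGauge k = 1 := if_neg (by omega)

theorem isGauge_boundedGauge : IsGauge boundedGauge where
  eq_zero w hw := if_pos hw
  zero_eq := boundedGauge_natCast 0
  nonneg w := by
    rw [boundedGauge]
    split_ifs <;> norm_num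
  anti v w hv hvw := by simp [boundedGauge, not_lt.mpr hv, not_lt.mpr (hv.trans hvw)]
  mul_le' v w hv hw := by
    simp [boundedGauge, not_lt.mpr hv, not_lt.mpr hw, not_lt.mpr (add_nonneg hv hw)]

variable {K : Type*} [NormedField K] [IsUltrametricDist K] [CompleteSpace K] {n : ℕ}

theorem exists_norm_le_of_lt_one {ι : Type*} [Finite ι] (x : ι → K) (hx : ∀ i, ‖x i‖ < 1) :
    ∃ r, 0 ≤ r ∧ r < 1 ∧ ∀ i, ‖x i‖ ≤ r := by
  rcases isEmpty_or_nonempty ι with h | h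
  · exact ⟨0, le_rfl, one_pos, fun i => h.elim i⟩
  · obtain ⟨i, hi⟩ := Finite.exists_max fun i => ‖x i‖
    exact ⟨‖x i‖, norm_nonneg _, hx i, hi⟩

/-- Here the decay comes from the point: the finitely many coordinates are bounded by some `r < 1`,
and `r ^ a.degree` tends to `0`. -/
theorem isTame_boundedGauge {x : Fin n → K} (hx : ∀ i, ‖x i‖ < 1) :
    GenericFactorization.IsTame boundedGauge x where
  norm_le_one i := (hx i).le
  tendsto e := by
    obtain ⟨r, hr0, hr1, hr⟩ := exists_norm_le_of_lt_one x hx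
    refine squeeze_zero (fun a => mul_nonneg (isGauge_boundedGauge.nonneg _) (norm_nonneg _))
      (fun a => ?_) ((tendsto_pow_atTop_nhds_zero_of_lt_one hr0 hr1).comp
        (tendsto_degree_cofinite n))
    exact (mul_le_of_le_one_left (norm_nonneg _) (isGauge_boundedGauge.le_one _)).trans
      (norm_monomialValue_le_pow hr a)

/-- Here the decay comes from the gauge: only finitely many exponents have bounded weight, and the
monomials need only be bounded by `1`. -/
theorem isTame_of_tendsto {ω : ℤ → ℝ} (hω : IsGauge ω) (h0 : Tendsto ω atTop (𝓝 0))
    {x : Fin n → K} (hx : ∀ i, ‖x i‖ ≤ 1) : GenericFactorization.IsTame ω x where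
  norm_le_one := hx
  tendsto e := by
    have h1 : Tendsto (fun a : Fin n →₀ ℕ => (wt a : ℤ) + e) cofinite atTop :=
      tendsto_atTop_add_const_right _ e
        (tendsto_natCast_atTop_atTop.comp (tendsto_wt_cofinite n))
    refine squeeze_zero (fun a => mul_nonneg (hω.nonneg _) (norm_nonneg _))
      (fun a => ?_) (h0.comp h1)
    refine mul_le_of_le_one_right (hω.nonneg _) ?_
    simpa using norm_monomialValue_le_pow hx a

/-- The parameters `(ε, ρ)` for which `k ↦ max ε (ρ ^ k)` bounds `θ`. -/
def GaugeParam (θ : ℕ → ℝ) : Type :=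
  {y : ℝ × ℝ // 0 < y.1 ∧ y.1 ≤ 1 ∧ 0 < y.2 ∧ y.2 < 1 ∧ ∀ k, θ k ≤ max y.1 (y.2 ^ k)}

/-- Beyond some `L` the sequence is below `ε`. On `0 < k ≤ L` it is bounded by some `δ < 1`, so any
`ρ < 1` close enough to `1` that `δ < ρ ^ L` works. -/
theorem exists_gaugeParam {θ : ℕ → ℝ} (h0 : θ 0 ≤ 1) (h1 : ∀ k > 0, θ k < 1)
    (h : Tendsto θ atTop (𝓝 0)) {ε : ℝ} (hε : 0 < ε) (hε1 : ε ≤ 1) :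
    ∃ y : GaugeParam θ, y.1.1 = ε := by
  obtain ⟨L, hL⟩ := eventually_atTop.mp (h.eventually (gt_mem_nhds hε))
  have hδ : ∀ M : ℕ, ∃ δ < 1, ∀ k, 0 < k → k ≤ M → θ k ≤ δ := by
    intro M
    induction M with
    | zero => exact ⟨0, one_pos, fun k hk hk' => by omega⟩
    | succ M ih =>
      obtain ⟨δ, hδ, hk⟩ := ih
      refine ⟨max δ (θ (M + 1)), max_lt hδ (h1 _ (by omega)), fun k hk0 hkM => ?_⟩
      rcases Nat.lt_or_ge M k with hMk | hMk
      · rw [show k = M + 1 by omega]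
        exact le_max_right _ _
      · exact (hk k hk0 hMk).trans (le_max_left _ _)
  obtain ⟨δ, hδ1, hδ⟩ := hδ L
  have hc : Tendsto (fun ρ : ℝ => ρ ^ L) (𝓝[<] 1) (𝓝 1) := by
    have h2 : Tendsto (fun ρ : ℝ => ρ ^ L) (𝓝 1) (𝓝 (1 ^ L)) := (continuous_pow L).tendsto 1
    rw [one_pow] at h2
    exact h2.mono_left nhdsWithin_le_nhds
  have h3 : ∀ᶠ ρ : ℝ in 𝓝[<] 1, δ < ρ ^ L ∧ 0 < ρ ∧ ρ < 1 :=
    (hc.eventually (lt_mem_nhds hδ1)).and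
      (((lt_mem_nhds one_pos).filter_mono nhdsWithin_le_nhds).and self_mem_nhdsWithin)
  obtain ⟨ρ, hρ, hρ0, hρ1⟩ := h3.exists
  refine ⟨⟨(ε, ρ), hε, hε1, hρ0, hρ1, fun k => ?_⟩, rfl⟩
  rcases Nat.eq_zero_or_pos k with rfl | hk
  · simpa using Or.inr h0
  rcases le_or_gt L k with hLk | hLk
  · exact (hL k hLk).le.trans (le_max_left _ _)
  · exact (hδ k hk hLk.le).trans (hρ.le.trans ((pow_le_pow_of_le_one hρ0.le hρ1.le hLk.le).trans
      (le_max_right _ _)))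

/-- The smallest of the gauges `k ↦ max ε (ρ ^ k)` bounding `θ`. -/
def decayGauge (θ : ℕ → ℝ) (w : ℤ) : ℝ :=
  if w < 0 then 0 else ⨅ y : GaugeParam θ, max y.1.1 (y.1.2 ^ w.toNat)

theorem decayGauge_le {θ : ℕ → ℝ} (y : GaugeParam θ) {w : ℤ} (hw : 0 ≤ w) :
    decayGauge θ w ≤ max y.1.1 (y.1.2 ^ w.toNat) := by
  rw [decayGauge, if_neg (not_lt.mpr hw)]
  refine ciInf_le ⟨0, ?_⟩ y
  rintro _ ⟨z, rfl⟩
  exact z.2.1.le.trans (le_max_left _ _)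

theorem le_decayGauge {θ : ℕ → ℝ} (y₀ : GaugeParam θ) {w : ℤ} (hw : 0 ≤ w) {c : ℝ}
    (h : ∀ y : GaugeParam θ, c ≤ max y.1.1 (y.1.2 ^ w.toNat)) : c ≤ decayGauge θ w := by
  rw [decayGauge, if_neg (not_lt.mpr hw)]
  have : Nonempty (GaugeParam θ) := ⟨y₀⟩
  exact le_ciInf h

/-- Each `k ↦ max ε (ρ ^ k)` satisfies the product inequality but does not tend to `0`. The
inequality survives an infimum, and since `ε` may be arbitrarily small the infimum does tend to `0`.
-/
theorem exists_gauge {θ : ℕ → ℝ} (h0 : θ 0 ≤ 1) (h1 : ∀ k > 0, θ k < 1)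
    (h : Tendsto θ atTop (𝓝 0)) :
    ∃ ω, IsGauge ω ∧ (∀ k : ℕ, θ k ≤ ω k) ∧ (∀ w > 0, ω w < 1) ∧ Tendsto ω atTop (𝓝 0) := by
  -- Any `ε < 1` would do: `y₀` shows that the infimum is over a nonempty set and gives the strict
  -- bound in positive weights.
  obtain ⟨y₀, hy₀⟩ := exists_gaugeParam h0 h1 h one_half_pos (by norm_num)
  have hnonneg : ∀ w, 0 ≤ decayGauge θ w := fun w => by
    rcases lt_or_ge w 0 with hw | hw
    · rw [decayGauge, if_pos hw]
    · exact le_decayGauge y₀ hw fun y => y.2.1.le.trans (le_max_left _ _)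
  refine ⟨decayGauge θ, ⟨fun w hw => if_pos hw, ?_, hnonneg, fun v w hv hvw => ?_,
    fun v w hv hw => ?_⟩, fun k => ?_, fun w hw => ?_, ?_⟩
  · refine le_antisymm ((decayGauge_le y₀ le_rfl).trans ?_) (le_decayGauge y₀ le_rfl fun y => ?_)
    · simpa using y₀.2.2.1
    · simp
  · refine le_decayGauge y₀ hv fun y => (decayGauge_le y (hv.trans hvw)).trans ?_
    exact max_le_max le_rfl (pow_le_pow_of_le_one y.2.2.2.1.le y.2.2.2.2.1.le
      (Int.toNat_le_toNat hvw))
  · refine le_decayGauge y₀ (add_nonneg hv hw) fun y => ?_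
    obtain ⟨hε0, hε1, hρ0, hρ1, -⟩ := y.2
    refine (mul_le_mul (decayGauge_le y hv) (decayGauge_le y hw) (hnonneg _)
      (hε0.le.trans (le_max_left _ _))).trans ?_
    rw [Int.toNat_add hv hw, pow_add]
    have hv1 : y.1.2 ^ v.toNat ≤ 1 := pow_le_one₀ hρ0.le hρ1.le
    have hw1 : y.1.2 ^ w.toNat ≤ 1 := pow_le_one₀ hρ0.le hρ1.le
    rcases le_total y.1.1 (y.1.2 ^ v.toNat) with ha | ha <;>
    rcases le_total y.1.1 (y.1.2 ^ w.toNat) with hb | hb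
    · rw [max_eq_right ha, max_eq_right hb]
      exact le_max_right _ _
    · rw [max_eq_right ha, max_eq_left hb]
      exact (mul_le_of_le_one_left hε0.le hv1).trans (le_max_left _ _)
    · rw [max_eq_left ha, max_eq_right hb]
      exact (mul_le_of_le_one_right hε0.le hw1).trans (le_max_left _ _)
    · rw [max_eq_left ha, max_eq_left hb]
      exact (mul_le_of_le_one_right hε0.le hε1).trans (le_max_left _ _)
  · exact le_decayGauge y₀ (by omega) fun y => by simpa using y.2.2.2.2.2 k
  · refine (decayGauge_le y₀ hw.le).trans_lt (max_lt ?_ ?_)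
    · rw [hy₀]
      norm_num
    · exact pow_lt_one₀ y₀.2.2.2.1.le y₀.2.2.2.2.1 (by omega)
  · rw [tendsto_order]
    refine ⟨fun a ha => Eventually.of_forall fun w => ha.trans_le (hnonneg w), fun a ha => ?_⟩
    obtain ⟨y, hy⟩ := exists_gaugeParam h0 h1 h (ε := min (a / 2) 1) (by positivity)
      (min_le_right _ _)
    have h2 : Tendsto (fun w : ℤ => y.1.2 ^ w.toNat) atTop (𝓝 0) :=
      (tendsto_pow_atTop_nhds_zero_of_lt_one y.2.2.2.1.le y.2.2.2.2.1).comp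
        (tendsto_atTop.mpr fun b => (eventually_ge_atTop (b : ℤ)).mono fun w hw => by omega)
    filter_upwards [h2.eventually (gt_mem_nhds ha), eventually_ge_atTop (0 : ℤ)] with w hw hw0
    refine (decayGauge_le y hw0).trans_lt (max_lt ?_ hw)
    rw [hy]
    exact (min_le_left _ _).trans_lt (half_lt_self ha)

end Gauges

variable {p : ℕ} [Fact p.Prime]

/-! ### Valuations and values of one-variable series -/

section Valuation

theorem vp_le_vp_of_norm_le {x y : ℂ_[p]} (h : ‖y‖ ≤ ‖x‖) : vp x ≤ vp y := by
  have hp : (1 : ℝ) < p := by exact_mod_cast (Fact.out : p.Prime).one_lt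
  by_cases hy : y = 0
  · rw [vp, vp, if_pos hy]
    exact le_top
  · have hy' : 0 < ‖y‖ := norm_pos_iff.mpr hy
    have hx : x ≠ 0 := norm_pos_iff.mp (hy'.trans_le h)
    rw [vp, vp, if_neg hy, if_neg hx, EReal.coe_le_coe_iff, neg_le_neg_iff]
    exact Real.logb_le_logb_of_le hp hy' h

theorem vp_eq_vp_of_norm_eq {x y : ℂ_[p]} (h : ‖x‖ = ‖y‖) : vp x = vp y :=
  le_antisymm (vp_le_vp_of_norm_le h.ge) (vp_le_vp_of_norm_le h.le)

theorem min_vp_le_vp {x y z : ℂ_[p]} (h : ‖z‖ ≤ max ‖x‖ ‖y‖) : min (vp x) (vp y) ≤ vp z := by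
  rcases le_max_iff.mp h with h | h
  · exact min_le_of_left_le (vp_le_vp_of_norm_le h)
  · exact min_le_of_right_le (vp_le_vp_of_norm_le h)

end Valuation

section EvalAt

theorem evalAt_mul {F G : PowerSeries ℂ_[p]} {x : ℂ_[p]}
    (hF : Summable fun i => PowerSeries.coeff i F * x ^ i)
    (hG : Summable fun i => PowerSeries.coeff i G * x ^ i) :
    evalAt (F * G) x = evalAt F x * evalAt G x :=
  (summable_coeff_mul hF hG).tsum_eq

theorem hasSum_coe (P : Polynomial ℂ_[p]) (x : ℂ_[p]) :
    HasSum (fun i => PowerSeries.coeff i (P : PowerSeries ℂ_[p]) * x ^ i) (P.eval x) := by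
  rw [Polynomial.eval_eq_sum_range]
  simp only [Polynomial.coeff_coe]
  refine hasSum_sum_of_ne_finset_zero fun i hi => ?_
  rw [Polynomial.coeff_eq_zero_of_natDegree_lt (by simpa using hi), zero_mul]

theorem evalAt_coe (P : Polynomial ℂ_[p]) (x : ℂ_[p]) : evalAt (P : PowerSeries ℂ_[p]) x = P.eval x :=
  (hasSum_coe P x).tsum_eq

theorem ConvergesOn.mul {D : Set ℂ_[p]} {F G : PowerSeries ℂ_[p]} (hF : ConvergesOn D F)
    (hG : ConvergesOn D G) : ConvergesOn D (F * G) := fun x hx =>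
  (summable_coeff_mul (hF x hx) (hG x hx)).summable

theorem convergesOn_coe (D : Set ℂ_[p]) (P : Polynomial ℂ_[p]) :
    ConvergesOn D (P : PowerSeries ℂ_[p]) := fun x _ => (hasSum_coe P x).summable

theorem evalAt_coe_mul {D : Set ℂ_[p]} {h : PowerSeries ℂ_[p]} (hh : ConvergesOn D h)
    (P : Polynomial ℂ_[p]) {x : ℂ_[p]} (hx : x ∈ D) :
    evalAt ((P : PowerSeries ℂ_[p]) * h) x = P.eval x * evalAt h x := by
  rw [evalAt_mul (hasSum_coe P x).summable (hh x hx), evalAt_coe]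

/-- A power series whose constant term dominates has values of absolute value `1`. -/
theorem norm_evalAt_eq_one {h : PowerSeries ℂ_[p]} {x : ℂ_[p]}
    (hs : Summable fun i => PowerSeries.coeff i h * x ^ i) (h0 : ‖PowerSeries.coeff 0 h‖ = 1)
    {c : ℝ} (hc0 : 0 ≤ c) (hc : c < 1)
    (hi : ∀ i, ‖PowerSeries.coeff (i + 1) h * x ^ (i + 1)‖ ≤ c) : ‖evalAt h x‖ = 1 := by
  rw [evalAt, hs.tsum_eq_zero_add, pow_zero, mul_one]
  have h1 : ‖∑' i, PowerSeries.coeff (i + 1) h * x ^ (i + 1)‖ ≤ c :=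
    IsUltrametricDist.norm_tsum_le_of_forall_le_of_nonneg hc0 hi
  rw [IsUltrametricDist.norm_add_eq_max_of_norm_ne_norm, h0]
  · exact max_eq_left (h1.trans hc.le)
  · rw [h0]
    exact (h1.trans_lt hc).ne'

end EvalAt

/-! ### Consequences of a prepared factorisation -/

section Prepared

/-- A factorisation `F = F_n P h` over the disc `D`, with `P` monic of degree `n` with integral
coefficients and roots in `D`, and with `h` of absolute value `1` on `D`. -/
structure IsPrepared (D : Set ℂ_[p]) (F : PowerSeries ℂ_[p]) (n : ℕ) (P : Polynomial ℂ_[p])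
    (h : PowerSeries ℂ_[p]) : Prop where
  monic : P.Monic
  natDegree_eq : P.natDegree = n
  coeff_ne_zero : PowerSeries.coeff n F ≠ 0
  norm_coeff_le : ∀ i, ‖P.coeff i‖ ≤ 1
  mem_of_isRoot : ∀ z, P.IsRoot z → z ∈ D
  convergesOn : ConvergesOn D h
  norm_evalAt : ∀ x ∈ D, ‖evalAt h x‖ = 1
  eq_mul : F = PowerSeries.C (PowerSeries.coeff n F) * (P : PowerSeries ℂ_[p]) * h

namespace IsPrepared

variable {D : Set ℂ_[p]} {F G : PowerSeries ℂ_[p]} {n N : ℕ} {P Q : Polynomial ℂ_[p]}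
  {h k : PowerSeries ℂ_[p]}

theorem evalAt_eq (H : IsPrepared D F n P h) {x : ℂ_[p]} (hx : x ∈ D) :
    evalAt F x = PowerSeries.coeff n F * P.eval x * evalAt h x := by
  conv_lhs => rw [H.eq_mul, ← Polynomial.coe_C, ← Polynomial.coe_mul]
  rw [evalAt_coe_mul H.convergesOn _ hx, Polynomial.eval_mul, Polynomial.eval_C]

theorem evalAt_ne_zero (H : IsPrepared D F n P h) {x : ℂ_[p]} (hx : x ∈ D) : evalAt h x ≠ 0 := by
  rw [← norm_pos_iff, H.norm_evalAt x hx]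
  exact one_pos

open scoped Classical in
theorem zeros_eq (H : IsPrepared D F n P h) : zeros D F = P.roots.toFinset := by
  ext z
  rw [Finset.mem_coe, Multiset.mem_toFinset, Polynomial.mem_roots H.monic.ne_zero]
  constructor
  · rintro ⟨hz, h0⟩
    rw [H.evalAt_eq hz] at h0
    simpa [H.coeff_ne_zero, H.evalAt_ne_zero hz] using h0
  · intro hz
    have hzD := H.mem_of_isRoot z hz
    refine ⟨hzD, ?_⟩
    rw [H.evalAt_eq hzD, hz.eq_zero, mul_zero, zero_mul]

/-- If a higher power of `X - z` divided `F` with convergent quotient, cancelling `(X - z) ^ e` and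
evaluating at `z` would give `0` on one side and the nonzero number `F_n q(z) h(z)` on the other. -/
theorem zeroMult_eq (H : IsPrepared D F n P h) {z : ℂ_[p]} (hz : z ∈ D) :
    zeroMult D F z = P.rootMultiplicity z := by
  obtain ⟨q, hq, hq'⟩ := Polynomial.exists_eq_pow_rootMultiplicity_mul_and_not_dvd P
    H.monic.ne_zero z
  set e := P.rootMultiplicity z
  have hX : ((Polynomial.X - Polynomial.C z : Polynomial ℂ_[p]) : PowerSeries ℂ_[p]) =
      PowerSeries.X - PowerSeries.C z := by simp
  have hF : F = (PowerSeries.X - PowerSeries.C z) ^ e *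
      (((Polynomial.C (PowerSeries.coeff n F) * q : Polynomial ℂ_[p]) : PowerSeries ℂ_[p]) * h) := by
    conv_lhs => rw [H.eq_mul, hq]
    rw [← hX, Polynomial.coe_mul, Polynomial.coe_mul, Polynomial.coe_pow, Polynomial.coe_C]
    ring
  refine IsGreatest.csSup_eq ⟨⟨_, (convergesOn_coe D _).mul H.convergesOn, hF⟩, ?_⟩
  rintro l ⟨S, hS, hFS⟩
  by_contra hl
  obtain ⟨m, rfl⟩ := Nat.exists_eq_add_of_lt (not_le.mp hl)
  have hne : (PowerSeries.X - PowerSeries.C z : PowerSeries ℂ_[p]) ^ e ≠ 0 := by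
    refine pow_ne_zero _ fun h0 => ?_
    have h1 := congrArg (PowerSeries.coeff 1) h0
    simp at h1
  have h1 : ((Polynomial.C (PowerSeries.coeff n F) * q : Polynomial ℂ_[p]) : PowerSeries ℂ_[p]) * h =
      (((Polynomial.X - Polynomial.C z) ^ (m + 1) : Polynomial ℂ_[p]) : PowerSeries ℂ_[p]) * S := by
    refine mul_left_cancel₀ hne ?_
    rw [← hF, Polynomial.coe_pow, hX, ← mul_assoc, ← pow_add, ← add_assoc]
    exact hFS
  have h2 := congrArg (fun T => evalAt T z) h1
  simp only [evalAt_coe_mul H.convergesOn _ hz, evalAt_coe_mul hS _ hz] at h2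
  have h3 : q.eval z ≠ 0 := fun h0 => hq' (Polynomial.dvd_iff_isRoot.mpr h0)
  simp [H.coeff_ne_zero, H.evalAt_ne_zero hz, h3] at h2

theorem card_roots (H : IsPrepared D F n P h) : P.roots.card = n := by
  rw [← H.natDegree_eq]
  exact Polynomial.splits_iff_card_roots.mp (IsAlgClosed.splits P)

theorem finprod_zeros (H : IsPrepared D F n P h) (φ : ℂ_[p] → ℂ_[p]) :
    ∏ᶠ z ∈ zeros D F, φ z ^ zeroMult D F z = (P.roots.map φ).prod := by
  classical
  rw [Finset.prod_multiset_map_count, H.zeros_eq, finprod_mem_coe_finset]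
  refine Finset.prod_congr rfl fun z hz => ?_
  rw [Multiset.mem_toFinset, Polynomial.mem_roots H.monic.ne_zero] at hz
  rw [Polynomial.count_roots, H.zeroMult_eq (H.mem_of_isRoot z hz)]

theorem resultantExists (H : IsPrepared D F n P h) (hG : ConvergesOn D G) :
    ResultantExists D n F G := by
  classical
  refine ⟨?_, ?_, ?_, fun z hz => hG z hz.1⟩
  · rw [H.zeros_eq]
    exact Finset.finite_toSet _
  · intro z hz
    have hz' := hz
    rw [H.zeros_eq, Finset.mem_coe, Multiset.mem_toFinset,
      Polynomial.mem_roots H.monic.ne_zero] at hz'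
    rw [H.zeroMult_eq hz.1]
    exact (Polynomial.rootMultiplicity_pos H.monic.ne_zero).mpr hz'
  · rw [H.zeros_eq, finsum_mem_coe_finset, ← H.card_roots, ← Multiset.toFinset_sum_count_eq]
    refine Finset.sum_congr rfl fun z hz => ?_
    rw [Multiset.mem_toFinset, Polynomial.mem_roots H.monic.ne_zero] at hz
    rw [Polynomial.count_roots, H.zeroMult_eq (H.mem_of_isRoot z hz)]

theorem discResultant_eq (H : IsPrepared D F n P h) (N : ℕ) (G : PowerSeries ℂ_[p]) :
    discResultant D n N F G = PowerSeries.coeff n F ^ N * (P.roots.map fun z => evalAt G z).prod := by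
  rw [discResultant, H.finprod_zeros]

theorem natDegree_C_mul (H : IsPrepared D F n P h) :
    (Polynomial.C (PowerSeries.coeff n F) * P).natDegree = n := by
  rw [Polynomial.natDegree_C_mul H.coeff_ne_zero, H.natDegree_eq]

theorem resultant_eq (H : IsPrepared D F n P h) (H' : IsPrepared D G N Q k) :
    (Polynomial.C (PowerSeries.coeff n F) * P).resultant
      (Polynomial.C (PowerSeries.coeff N G) * Q) =
    PowerSeries.coeff n F ^ N * PowerSeries.coeff N G ^ n * (P.roots.map fun z => Q.eval z).prod := by
  rw [H.natDegree_C_mul, H'.natDegree_C_mul, Polynomial.resultant_C_mul_left,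
    Polynomial.resultant_C_mul_right]
  have h1 := Polynomial.resultant_eq_prod_eval P Q N H'.natDegree_eq.le (IsAlgClosed.splits P)
  rw [H.natDegree_eq, H.monic.leadingCoeff, one_pow, one_mul] at h1
  rw [h1, mul_assoc]

theorem eval_eq_finprod (H' : IsPrepared D G N Q k) (z : ℂ_[p]) (m : ℕ) :
    ∏ᶠ w ∈ zeros D G, (z - w) ^ (m * zeroMult D G w) = Q.eval z ^ m := by
  simp only [pow_mul]
  rw [H'.finprod_zeros, Multiset.prod_map_pow]
  congr 1
  conv_rhs => rw [(IsAlgClosed.splits Q).eq_prod_roots, H'.monic.leadingCoeff, map_one, one_mul,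
    Polynomial.eval_multiset_prod, Multiset.map_map]
  simp

/-- The ring of integers of `ℂ_[p]`, described by the norm. -/
def integers (p : ℕ) [Fact p.Prime] : Subring ℂ_[p] where
  carrier := {x | ‖x‖ ≤ 1}
  mul_mem' := fun {x y} hx hy => by
    change ‖x * y‖ ≤ 1
    rw [norm_mul]
    exact mul_le_one₀ hx (norm_nonneg y) hy
  one_mem' := by simp
  zero_mem' := by simp
  add_mem' := fun hx hy => (IsUltrametricDist.norm_add_le_max _ _).trans (max_le hx hy)
  neg_mem' := fun {x} hx => by
    change ‖-x‖ ≤ 1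
    rw [norm_neg]
    exact hx

/-- Over the ring of integers the resultant is `a f + b g` with integral `a` and `b`; evaluate at
`x`. The degree hypothesis excludes two constants, whose resultant is `1` whatever their size. -/
theorem norm_resultant_le {f g : Polynomial ℂ_[p]} (hf : ∀ i, ‖f.coeff i‖ ≤ 1)
    (hg : ∀ i, ‖g.coeff i‖ ≤ 1) (hfg : f.natDegree ≠ 0 ∨ g.natDegree ≠ 0) {x : ℂ_[p]}
    (hx : ‖x‖ ≤ 1) : ‖f.resultant g‖ ≤ max ‖f.eval x‖ ‖g.eval x‖ := by
  have hlift : ∀ q : Polynomial ℂ_[p], (∀ i, ‖q.coeff i‖ ≤ 1) →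
      ∃ q' : Polynomial (integers p), q'.map (integers p).subtype = q := fun q hq => by
    rw [← Polynomial.mem_lifts, Polynomial.lifts_iff_coeff_lifts]
    exact fun i => ⟨⟨q.coeff i, hq i⟩, rfl⟩
  obtain ⟨f, rfl⟩ := hlift f hf
  obtain ⟨g, rfl⟩ := hlift g hg
  have hinj : Function.Injective (integers p).subtype := Subtype.val_injective
  rw [Polynomial.natDegree_map_eq_of_injective hinj, Polynomial.natDegree_map_eq_of_injective hinj]
    at hfg ⊢
  rw [Polynomial.resultant_map_map]
  obtain ⟨a, b, -, -, hab⟩ := Polynomial.exists_mul_add_mul_eq_C_resultant f g le_rfl le_rfl hfg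
  let y : integers p := ⟨x, hx⟩
  have h1 := congrArg (fun q => (integers p).subtype (q.eval y)) hab
  have heval : ∀ q : Polynomial (integers p),
      (q.map (integers p).subtype).eval x = (integers p).subtype (q.eval y) := fun q => by
    rw [Polynomial.eval_map, ← Polynomial.eval₂_at_apply]
    rfl
  simp only [Polynomial.eval_add, Polynomial.eval_mul, Polynomial.eval_C, map_add, map_mul] at h1
  rw [← h1, heval, heval]
  refine (IsUltrametricDist.norm_add_le_max _ _).trans (max_le_max ?_ ?_)
  · rw [norm_mul]
    exact mul_le_of_le_one_right (norm_nonneg _) (a.eval y).2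
  · rw [norm_mul]
    exact mul_le_of_le_one_right (norm_nonneg _) (b.eval y).2

/-- At a root `z` of `P` one has `G(z) = G_N Q(z) k(z)`, so the two resultants differ by the product
of the `k(z)`, of norm `1`. In the same way `F(x)` and `G(x)` have the norms of the corresponding
polynomials throughout `D`. -/
theorem resultantComparison (hD : D ⊆ closedDisc p) (H : IsPrepared D F n P h)
    (H' : IsPrepared D G N Q k) :
    ResultantComparison D n N F G (discResultant D n N F G)
      (Polynomial.C (PowerSeries.coeff n F) * P) (Polynomial.C (PowerSeries.coeff N G) * Q) := by
  have hroot : ∀ z ∈ P.roots, z ∈ D := fun z hz => H.mem_of_isRoot z (Polynomial.isRoot_of_mem_roots hz)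
  refine ⟨?_, ?_, ?_, ?_⟩
  · have h1 : discResultant D n N F G =
        (Polynomial.C (PowerSeries.coeff n F) * P).resultant
          (Polynomial.C (PowerSeries.coeff N G) * Q) *
        (P.roots.map fun z => evalAt k z).prod := by
      rw [H.discResultant_eq, H.resultant_eq H', Multiset.map_congr rfl fun z hz =>
        H'.evalAt_eq (hroot z hz), Multiset.prod_map_mul, Multiset.prod_map_mul,
        Multiset.map_const', Multiset.prod_replicate, H.card_roots]
      ring
    have h2 : ‖(P.roots.map fun z => evalAt k z).prod‖ = 1 := by
      refine Multiset.prod_induction (fun y : ℂ_[p] => ‖y‖ = 1) _ (fun a b ha hb => ?_)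
        norm_one fun y hy => ?_
      · rw [norm_mul, ha, hb, one_mul]
      · obtain ⟨z, hz, rfl⟩ := Multiset.mem_map.mp hy
        exact H'.norm_evalAt z (hroot z hz)
    refine vp_eq_vp_of_norm_eq ?_
    rw [h1, norm_mul, h2, mul_one]
  · rw [H.resultant_eq H']
    congr 1
    rw [← H.finprod_zeros]
    exact finprod_mem_congr rfl fun z _ => (H'.eval_eq_finprod z _).symm
  · rw [Polynomial.resultant, H.natDegree_C_mul, H'.natDegree_C_mul]
  · intro hF hG hne
    refine iSup₂_le fun x hx => min_vp_le_vp ?_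
    rw [H.evalAt_eq hx, H'.evalAt_eq hx, norm_mul, norm_mul (_ * _) (evalAt k x),
      H.norm_evalAt x hx, H'.norm_evalAt x hx, mul_one, mul_one]
    -- For two constants the resultant is `1`, and the bound fails only if both have norm `< 1`,
    -- which is precisely the excluded case.
    by_cases hnN : n = 0 ∧ N = 0
    · obtain ⟨rfl, rfl⟩ := hnN
      have hP : P = 1 := H.monic.natDegree_eq_zero.mp H.natDegree_eq
      have hQ : Q = 1 := H'.monic.natDegree_eq_zero.mp H'.natDegree_eq
      rw [H.resultant_eq H', hP, hQ]
      simp only [pow_zero, Polynomial.roots_one, Multiset.empty_eq_zero, Multiset.map_zero,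
        Multiset.prod_zero, mul_one, norm_one, Polynomial.eval_one]
      by_contra hcon
      rw [not_le, max_lt_iff] at hcon
      exact hne ⟨rfl, rfl, hcon⟩
    · have h1 := norm_resultant_le (f := Polynomial.C (PowerSeries.coeff n F) * P)
        (g := Polynomial.C (PowerSeries.coeff N G) * Q)
        (fun i => by
          rw [Polynomial.coeff_C_mul, norm_mul]
          exact mul_le_one₀ (hF n) (norm_nonneg _) (H.norm_coeff_le i))
        (fun i => by
          rw [Polynomial.coeff_C_mul, norm_mul]
          exact mul_le_one₀ (hG N) (norm_nonneg _) (H'.norm_coeff_le i))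
        (by rw [H.natDegree_C_mul, H'.natDegree_C_mul]; tauto) (hD hx)
      simpa using h1

end IsPrepared

end Prepared

/-! ### Roots, convergence and degrees on the two discs -/

theorem norm_sum_lt_of_forall_lt {ι : Type*} {s : Finset ι} {f : ι → ℂ_[p]} {c : ℝ} (hc : 0 < c)
    (h : ∀ i ∈ s, ‖f i‖ < c) : ‖∑ i ∈ s, f i‖ < c := by
  classical
  induction s using Finset.induction_on with
  | empty => simpa using hc
  | insert a s ha ih =>
    rw [Finset.sum_insert ha]
    exact (IsUltrametricDist.norm_add_le_max _ _).trans_lt (max_lt (h _ (mem_insert_self _ _))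
      (ih fun i hi => h i (mem_insert_of_mem hi)))

/-- A root of absolute value at least `1` of a monic polynomial is bounded by the lower
coefficients. -/
theorem norm_root_le {P : Polynomial ℂ_[p]} (hP : P.Monic) {r : ℝ} (hr : 0 ≤ r)
    (hc : ∀ i < P.natDegree, ‖P.coeff i‖ ≤ r) {z : ℂ_[p]} (hz : P.IsRoot z) (h1 : 1 ≤ ‖z‖) :
    ‖z‖ ≤ r := by
  rcases Nat.eq_zero_or_pos P.natDegree with h0 | h0
  · rw [hP.natDegree_eq_zero.mp h0] at hz
    simp at hz
  obtain ⟨m, hm⟩ := Nat.exists_eq_add_of_lt h0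
  rw [zero_add] at hm
  have h2 : z ^ (m + 1) = -∑ i ∈ range (m + 1), P.coeff i * z ^ i := by
    have h3 := hz.eq_zero
    rw [Polynomial.eval_eq_sum_range, Finset.sum_range_succ, hP.coeff_natDegree, hm, one_mul] at h3
    linear_combination h3
  have h3 : ‖z‖ ^ (m + 1) ≤ r * ‖z‖ ^ m := by
    rw [← norm_pow, h2, norm_neg]
    refine IsUltrametricDist.norm_sum_le_of_forall_le_of_nonneg (by positivity) fun i hi => ?_
    rw [Finset.mem_range] at hi
    rw [norm_mul, norm_pow]
    exact mul_le_mul (hc i (by omega)) (pow_le_pow_right₀ h1 (by omega)) (by positivity) hr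
  rw [pow_succ'] at h3
  exact le_of_mul_le_mul_right h3 (by positivity)

theorem openDisc_subset : openDisc p ⊆ closedDisc p := fun x (hx : ‖x‖ < 1) => hx.le

theorem convergesOn_openDisc {F : PowerSeries ℂ_[p]} {c : ℝ}
    (h : ∀ i, ‖PowerSeries.coeff i F‖ ≤ c) : ConvergesOn (openDisc p) F := fun x hx => by
  have hx' : ‖x‖ < 1 := hx
  refine summable_of_norm_le_of_tendsto (g := fun i => c * ‖x‖ ^ i) ?_ fun i => ?_
  · rw [Nat.cofinite_eq_atTop]
    simpa using (tendsto_pow_atTop_nhds_zero_of_lt_one (norm_nonneg x) hx').const_mul c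
  · rw [norm_mul, norm_pow]
    gcongr
    exact h i

theorem tendsto_coeff_of_convergesOn_closedDisc {F : PowerSeries ℂ_[p]}
    (h : ConvergesOn (closedDisc p) F) :
    Tendsto (fun i => ‖PowerSeries.coeff i F‖) atTop (𝓝 0) := by
  have h1 := (h 1 (by simp [closedDisc])).tendsto_cofinite_zero
  rw [Nat.cofinite_eq_atTop] at h1
  simpa using h1.norm

theorem convergesOn_closedDisc {F : PowerSeries ℂ_[p]}
    (h : Tendsto (fun i => ‖PowerSeries.coeff i F‖) atTop (𝓝 0)) :
    ConvergesOn (closedDisc p) F := fun x hx => by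
  have hx' : ‖x‖ ≤ 1 := hx
  refine summable_of_norm_le_of_tendsto (by rwa [Nat.cofinite_eq_atTop]) fun i => ?_
  rw [norm_mul, norm_pow]
  exact mul_le_of_le_one_right (norm_nonneg _) (pow_le_one₀ (norm_nonneg _) hx')

/-- Convergence at `1` makes the coefficients tend to `0`, so the maximal norm is attained, and only
at finitely many indices. -/
theorem exists_isLwideg {F : PowerSeries ℂ_[p]} (hF : F ≠ 0) (h : ConvergesOn (closedDisc p) F) :
    ∃ m, IsLwideg F m := by
  have ht := tendsto_coeff_of_convergesOn_closedDisc h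
  obtain ⟨j, hj⟩ : ∃ j, PowerSeries.coeff j F ≠ 0 := by
    by_contra! hcon
    exact hF (PowerSeries.ext fun i => by simpa using hcon i)
  obtain ⟨L, hL⟩ := eventually_atTop.mp (ht.eventually (gt_mem_nhds (norm_pos_iff.mpr hj)))
  have hjL : j < L := by
    by_contra hcon
    exact lt_irrefl _ (hL j (not_lt.mp hcon))
  obtain ⟨l, hl, hmax⟩ := Finset.exists_max_image (range L) (fun i => ‖PowerSeries.coeff i F‖)
    ⟨j, Finset.mem_range.mpr hjL⟩
  have hle : ∀ i, ‖PowerSeries.coeff i F‖ ≤ ‖PowerSeries.coeff l F‖ := fun i => by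
    rcases lt_or_ge i L with hi | hi
    · exact hmax i (Finset.mem_range.mpr hi)
    · exact (hL i hi).le.trans (hmax j (Finset.mem_range.mpr hjL))
  have hl0 : 0 < ‖PowerSeries.coeff l F‖ := (norm_pos_iff.mpr hj).trans_le (hle j)
  let s := (range L).filter fun i => ‖PowerSeries.coeff i F‖ = ‖PowerSeries.coeff l F‖
  have hs : s.Nonempty := ⟨l, by simpa [s] using hl⟩
  have hm := s.max'_mem hs
  rw [Finset.mem_filter] at hm
  refine ⟨s.max' hs, ?_, ?_, ?_⟩
  · rw [← norm_pos_iff, hm.2]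
    exact hl0
  · rw [hm.2]
    exact hle
  · intro i hi
    rw [hm.2]
    refine lt_of_le_of_ne (hle i) fun heq => ?_
    rcases lt_or_ge i L with hiL | hiL
    · exact absurd (s.le_max' i (by simp [s, hiL, heq])) (not_le.mpr hi)
    · exact absurd heq ((hL i hiL).trans_le (hle j)).ne

/-- The coefficients tend to `0`, so strict bounds become uniform. This is read off from a gauge for
the coefficients, with the constant one replaced by `0`: its value at `1` is the bound. -/
theorem exists_lt_one_of_convergesOn {h : PowerSeries ℂ_[p]} (hc : ConvergesOn (closedDisc p) h)
    (hi : ∀ i > 0, ‖PowerSeries.coeff i h‖ < 1) :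
    ∃ c, 0 ≤ c ∧ c < 1 ∧ ∀ i > 0, ‖PowerSeries.coeff i h‖ ≤ c := by
  have h2 : Tendsto (fun i => if i = 0 then 0 else ‖PowerSeries.coeff i h‖) atTop (𝓝 0) := by
    refine (tendsto_coeff_of_convergesOn_closedDisc hc).congr' ?_
    filter_upwards [eventually_gt_atTop 0] with i hi0
    rw [if_neg hi0.ne']
  obtain ⟨ω, hω, hle, hlt, -⟩ := exists_gauge (θ := fun i => if i = 0 then 0 else
    ‖PowerSeries.coeff i h‖) (by simp) (fun k hk => by simpa [hk.ne'] using hi k hk) h2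
  refine ⟨ω 1, hω.nonneg _, hlt 1 one_pos, fun i hi0 => ?_⟩
  have h3 := hle i
  simp only [hi0.ne', if_false] at h3
  exact h3.trans (hω.anti 1 i (by norm_num) (by exact_mod_cast hi0))

/-! ### Distinguished polynomials give prepared factorisations -/

section Distinguished

variable {F : PowerSeries ℂ_[p]} {n : ℕ} {P : Polynomial ℂ_[p]}

theorem IsDistinguishedO.isPrepared (hn : PowerSeries.coeff n F ≠ 0)
    (hP : IsDistinguishedO F n P) : ∃ h, IsPrepared (openDisc p) F n P h := by
  obtain ⟨hm, hd, hc, U, hU0, hU, hF⟩ := hP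
  have hconv : ConvergesOn (openDisc p) U := convergesOn_openDisc hU
  refine ⟨U, hm, hd, hn, fun i => ?_, fun z hz => ?_, hconv, fun x hx => ?_, hF⟩
  · rcases lt_trichotomy i n with h | rfl | h
    · exact (hc i h).le
    · rw [← hd, hm.coeff_natDegree, norm_one]
    · rw [Polynomial.coeff_eq_zero_of_natDegree_lt (hd ▸ h), norm_zero]
      exact zero_le_one
  · obtain ⟨r, hr0, hr1, hr⟩ := exists_norm_le_of_lt_one (fun i : Fin n => P.coeff i)
      fun i => hc i i.2
    by_contra hcon
    have h1 : 1 ≤ ‖z‖ := not_lt.mp hcon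
    exact absurd (norm_root_le hm hr0 (fun i hi => hr ⟨i, hd ▸ hi⟩) hz h1)
      (not_le.mpr (hr1.trans_le h1))
  · have hx' : ‖x‖ < 1 := hx
    refine norm_evalAt_eq_one (hconv x hx) hU0 (norm_nonneg x) hx' fun i => ?_
    rw [norm_mul, norm_pow]
    exact (mul_le_of_le_one_left (by positivity) (hU _)).trans
      (pow_le_of_le_one (norm_nonneg x) hx'.le (by omega))

theorem IsDistinguishedC.isPrepared (hn : IsLwideg F n) (hP : IsDistinguishedC F n P) :
    ∃ h, IsPrepared (closedDisc p) F n P h := by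
  obtain ⟨hm, hd, h, hconv, h0, hi, hF⟩ := hP
  obtain ⟨c, hc0, hc1, hc⟩ := exists_lt_one_of_convergesOn hconv hi
  -- Integrality of `P` is not part of the definition. If `j` maximises `‖P_j‖`, then in the
  -- coefficient of index `j` of `P h` the term `P_j h_0` dominates, so `‖F_j‖ = ‖F_n‖ * ‖P_j‖`; now
  -- use the maximality of `‖F_n‖`.
  have hint : ∀ i, ‖P.coeff i‖ ≤ 1 := by
    obtain ⟨j, -, hj⟩ := Finset.exists_max_image (range (n + 1)) (fun i => ‖P.coeff i‖)
      ⟨0, by simp⟩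
    have hmax : ∀ i, ‖P.coeff i‖ ≤ ‖P.coeff j‖ := fun i => by
      rcases lt_or_ge n i with hni | hni
      · rw [Polynomial.coeff_eq_zero_of_natDegree_lt (hd ▸ hni), norm_zero]
        exact norm_nonneg _
      · exact hj i (by simpa using Nat.lt_succ_of_le hni)
    have hpos : 0 < ‖P.coeff j‖ := by
      refine lt_of_lt_of_le one_pos ?_
      have h1 := hmax n
      rwa [← hd, hm.coeff_natDegree, norm_one] at h1
    have h1 : PowerSeries.coeff j F = PowerSeries.coeff n F *
        (P.coeff j * PowerSeries.coeff 0 h + ∑ y ∈ (antidiagonal j).erase (j, 0),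
          P.coeff y.1 * PowerSeries.coeff y.2 h) := by
      rw [Finset.add_sum_erase (antidiagonal j) (fun y => P.coeff y.1 * PowerSeries.coeff y.2 h)
        (a := (j, 0)) (by simp)]
      conv_lhs => rw [hF, mul_assoc, PowerSeries.coeff_C_mul, PowerSeries.coeff_mul]
      simp only [Polynomial.coeff_coe]
    have h2 : ‖∑ y ∈ (antidiagonal j).erase (j, 0), P.coeff y.1 * PowerSeries.coeff y.2 h‖ <
        ‖P.coeff j‖ := by
      refine norm_sum_lt_of_forall_lt hpos fun y hy => ?_
      rw [Finset.mem_erase, HasAntidiagonal.mem_antidiagonal] at hy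
      have hy2 : y.2 > 0 := by
        by_contra hcon
        refine hy.1 (Prod.ext ?_ ?_) <;> simp <;> omega
      rw [norm_mul]
      exact (mul_le_mul_of_nonneg_right (hmax _) (norm_nonneg _)).trans_lt
        (mul_lt_of_lt_one_right hpos (hi _ hy2))
    have h3 := hn.2.1 j
    have h4 : ‖P.coeff j * PowerSeries.coeff 0 h‖ = ‖P.coeff j‖ := by rw [norm_mul, h0, mul_one]
    rw [h1, norm_mul, IsUltrametricDist.norm_add_eq_max_of_norm_ne_norm (by rw [h4]; exact h2.ne'),
      h4, max_eq_left h2.le] at h3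
    have h5 : ‖P.coeff j‖ ≤ 1 := le_of_mul_le_mul_left (by rwa [mul_one])
      (norm_pos_iff.mpr hn.1)
    exact fun i => (hmax i).trans h5
  refine ⟨h, hm, hd, hn.1, hint, fun z hz => ?_, hconv, fun x hx => ?_, hF⟩
  · by_contra hcon
    have h1 : 1 < ‖z‖ := not_le.mp hcon
    exact absurd (norm_root_le hm zero_le_one (fun i _ => hint i) hz h1.le) (not_le.mpr h1)
  · have hx' : ‖x‖ ≤ 1 := hx
    refine norm_evalAt_eq_one (hconv x hx) h0 hc0 hc1 fun i => ?_
    rw [norm_mul, norm_pow]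
    exact (mul_le_of_le_one_right (norm_nonneg _) (pow_le_one₀ (norm_nonneg _) hx')).trans
      (hc _ (by omega))

end Distinguished

/-! ### The evaluated generic factorisation of a given series -/

section Existence

variable {F : PowerSeries ℂ_[p]} {n : ℕ} (hF1 : ‖PowerSeries.coeff n F‖ = 1)
  {f : ℕ → ℂ_[p]} (hf : ∀ k ≥ n, f k = PowerSeries.coeff k F) (d : GenericFactorization n f)
  {ω : ℤ → ℝ} (hω : IsGauge ω)
  (hx : GenericFactorization.IsTame ω fun i : Fin n => PowerSeries.coeff (i : ℕ) F)
  (hFω : ∀ k : ℕ, ‖PowerSeries.coeff (n + k) F‖ ≤ ω k)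
include hF1 hf hω hx hFω

theorem evalPoly_mul_evalUnit_eq :
    F = PowerSeries.C (PowerSeries.coeff n F) *
      (d.evalPoly fun i : Fin n => PowerSeries.coeff (i : ℕ) F : PowerSeries ℂ_[p]) *
      (PowerSeries.C (PowerSeries.coeff n F)⁻¹ *
        d.evalUnit fun i : Fin n => PowerSeries.coeff (i : ℕ) F) := by
  have hne : PowerSeries.coeff n F ≠ 0 := norm_pos_iff.mp (by rw [hF1]; exact one_pos)
  have h1 := d.evalPoly_mul_evalUnit hω hx (by rw [hf n le_rfl, hF1])
    (fun k => by rw [hf _ (by omega)]; exact hFω k)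
  have h2 : (PowerSeries.mk fun i => if h : i < n then PowerSeries.coeff ((⟨i, h⟩ : Fin n) : ℕ) F
      else f i) = F := by
    ext i
    rw [PowerSeries.coeff_mk]
    split_ifs with h
    · rfl
    · exact hf i (not_lt.mp h)
  rw [h2] at h1
  have h3 : PowerSeries.C (PowerSeries.coeff n F) * PowerSeries.C (PowerSeries.coeff n F)⁻¹ = 1 := by
    rw [← map_mul, mul_inv_cancel₀ hne, map_one]
  linear_combination -(PowerSeries.C (PowerSeries.coeff n F) *
    PowerSeries.C (PowerSeries.coeff n F)⁻¹) * h1 - F * h3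

theorem norm_coeff_C_inv_mul_evalUnit_le (k : ℕ) :
    ‖PowerSeries.coeff k (PowerSeries.C (PowerSeries.coeff n F)⁻¹ *
      d.evalUnit fun i : Fin n => PowerSeries.coeff (i : ℕ) F)‖ ≤ ω k := by
  rw [PowerSeries.coeff_C_mul, norm_mul, norm_inv, hF1, inv_one, one_mul]
  exact d.norm_coeff_evalUnit_le hω hx (by rw [hf n le_rfl, hF1])
    (fun k => by rw [hf _ (by omega)]; exact hFω k) k

/-- The constant term of the unit factor has absolute value `1`, as soon as all other terms
contributing to the coefficient of index `n` are small. -/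
theorem norm_coeff_zero_C_inv_mul_evalUnit
    (hlt : ∀ i < n, ‖(d.evalPoly fun i : Fin n => PowerSeries.coeff (i : ℕ) F).coeff i‖ * ω (n - i)
      < 1) :
    ‖PowerSeries.coeff 0 (PowerSeries.C (PowerSeries.coeff n F)⁻¹ *
      d.evalUnit fun i : Fin n => PowerSeries.coeff (i : ℕ) F)‖ = 1 := by
  have hne : PowerSeries.coeff n F ≠ 0 := norm_pos_iff.mp (by rw [hF1]; exact one_pos)
  -- Comparing coefficients of index `n` and cancelling `F_n` gives `1 = U_0 + ∑_{i < n} P_i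
  -- U_{n-i}`, where the sum has norm `< 1`.
  have h1 := congrArg (PowerSeries.coeff n) (evalPoly_mul_evalUnit_eq hF1 hf d hω hx hFω)
  have hle := norm_coeff_C_inv_mul_evalUnit_le hF1 hf d hω hx hFω
  set U := PowerSeries.C (PowerSeries.coeff n F)⁻¹ *
      d.evalUnit fun i : Fin n => PowerSeries.coeff (i : ℕ) F
  rw [mul_assoc, PowerSeries.coeff_C_mul, PowerSeries.coeff_mul] at h1
  have h2 := mul_left_cancel₀ hne ((mul_one _).trans h1)
  rw [← Finset.add_sum_erase (antidiagonal n) _ (a := (n, 0)) (by simp)] at h2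
  simp only [Polynomial.coeff_coe] at h2
  have hP := (d.monic_evalPoly (x := fun i : Fin n => PowerSeries.coeff (i : ℕ) F)).coeff_natDegree
  rw [d.natDegree_evalPoly] at hP
  rw [hP, one_mul] at h2
  have h3 : ‖∑ y ∈ (antidiagonal n).erase (n, 0),
      (d.evalPoly fun i : Fin n => PowerSeries.coeff (i : ℕ) F).coeff y.1 *
        PowerSeries.coeff y.2 U‖ < 1 := by
    refine norm_sum_lt_of_forall_lt one_pos fun y hy => ?_
    rw [Finset.mem_erase, HasAntidiagonal.mem_antidiagonal] at hy
    have hy1 : y.1 < n := by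
      by_contra hcon
      refine hy.1 (Prod.ext ?_ ?_) <;> simp <;> omega
    refine lt_of_le_of_lt ?_ (hlt y.1 hy1)
    rw [norm_mul]
    refine mul_le_mul_of_nonneg_left ((hle _).trans (le_of_eq ?_)) (norm_nonneg _)
    congr 1
    omega
  have h4 : PowerSeries.coeff 0 U = 1 - ∑ y ∈ (antidiagonal n).erase (n, 0),
      (d.evalPoly fun i : Fin n => PowerSeries.coeff (i : ℕ) F).coeff y.1 *
        PowerSeries.coeff y.2 U := by linear_combination -h2
  rw [h4, sub_eq_add_neg, IsUltrametricDist.norm_add_eq_max_of_norm_ne_norm]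
  · rw [norm_neg, norm_one]
    exact max_eq_left h3.le
  · rw [norm_neg, norm_one]
    exact h3.ne'

end Existence

/-! ### Choice of gauges and existence of distinguished polynomials -/

section Gauged

variable {F : PowerSeries ℂ_[p]} {n : ℕ}

theorem IsWideg.isTame (hF : IsWideg F n) (hF1 : ‖PowerSeries.coeff n F‖ = 1) :
    GenericFactorization.IsTame boundedGauge fun i : Fin n => PowerSeries.coeff (i : ℕ) F :=
  isTame_boundedGauge fun i => hF1 ▸ hF.2.2 i i.2

/-- The two indices are unrelated so that the bound serves both for `F`, whose index is shifted by
`n`, and for `G`, whose index is not. -/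
theorem IsWideg.norm_coeff_le (hF : IsWideg F n) (k : ℕ) (l : ℕ) :
    ‖PowerSeries.coeff l F‖ ≤ ‖PowerSeries.coeff n F‖ * boundedGauge k := by
  rw [boundedGauge_natCast, mul_one]
  exact hF.2.1 l

theorem IsWideg.isDistinguishedO (hF : IsWideg F n) (hF1 : ‖PowerSeries.coeff n F‖ = 1)
    {f : ℕ → ℂ_[p]} (hf : ∀ k ≥ n, f k = PowerSeries.coeff k F) (d : GenericFactorization n f) :
    IsDistinguishedO F n (d.evalPoly fun i : Fin n => PowerSeries.coeff (i : ℕ) F) := by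
  have hω := isGauge_boundedGauge
  have hx := hF.isTame hF1
  have hFω : ∀ k : ℕ, ‖PowerSeries.coeff (n + k) F‖ ≤ boundedGauge k := fun k => by
    simpa [hF1] using hF.norm_coeff_le k (n + k)
  have hlt : ∀ i < n,
      ‖(d.evalPoly fun i : Fin n => PowerSeries.coeff (i : ℕ) F).coeff i‖ < 1 := fun i hi => by
    obtain ⟨r, hr0, hr1, hr⟩ := exists_norm_le_of_lt_one
      (fun i : Fin n => PowerSeries.coeff (i : ℕ) F) fun i => hF1 ▸ hF.2.2 i i.2
    exact (d.norm_coeff_evalPoly_le hω hx (by rw [hf n le_rfl, hF1])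
      (fun k => by rw [hf _ (by omega)]; exact hFω k) hr0 hr1.le hr hi).trans_lt hr1
  refine ⟨d.monic_evalPoly, d.natDegree_evalPoly, hlt, _, ?_, fun i => ?_,
    evalPoly_mul_evalUnit_eq hF1 hf d hω hx hFω⟩
  · exact norm_coeff_zero_C_inv_mul_evalUnit hF1 hf d hω hx hFω fun i hi =>
      (mul_le_of_le_one_right (norm_nonneg _) (hω.le_one _)).trans_lt (hlt i hi)
  · exact (norm_coeff_C_inv_mul_evalUnit_le hF1 hf d hω hx hFω i).trans (hω.le_one _)

theorem IsLwideg.exists_gauge (hF : IsLwideg F n) (hF1 : ‖PowerSeries.coeff n F‖ = 1)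
    (hFc : ConvergesOn (closedDisc p) F) {G : PowerSeries ℂ_[p]} {N : ℕ}
    (hGc : ConvergesOn (closedDisc p) G) (hG : IsLwideg G N) :
    ∃ (ω : ℤ → ℝ) (c : ℝ), IsGauge ω ∧ (∀ w > 0, ω w < 1) ∧ Tendsto ω atTop (𝓝 0) ∧
      (GenericFactorization.IsTame ω fun i : Fin n => PowerSeries.coeff (i : ℕ) F) ∧
      (∀ k : ℕ, ‖PowerSeries.coeff (n + k) F‖ ≤ ω k) ∧
      ∀ k : ℕ, ‖PowerSeries.coeff k G‖ ≤ c * ω k := by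
  -- The added `1` makes every `‖G_k‖ / c` strictly less than `1`, as a gauge requires at positive
  -- indices; `‖G_N‖` alone would give equality at `N`.
  set c := ‖PowerSeries.coeff N G‖ + 1 with hc
  have hc0 : 0 < c := by positivity
  have hGc' : ∀ k, ‖PowerSeries.coeff k G‖ / c < 1 := fun k => by
    rw [div_lt_one hc0]
    exact (hG.2.1 k).trans_lt (lt_add_one _)
  obtain ⟨ω, hω, hle, hlt, ht⟩ := PadicResultant.exists_gauge
    (θ := fun k => max ‖PowerSeries.coeff (n + k) F‖ (‖PowerSeries.coeff k G‖ / c))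
    (max_le hF1.le (hGc' 0).le)
    (fun k hk => max_lt (hF1 ▸ hF.2.2 (n + k) (by omega)) (hGc' k))
    (by
      have h1 := (tendsto_coeff_of_convergesOn_closedDisc hFc).comp
        (tendsto_atTop_mono (fun k => Nat.le_add_left k n) tendsto_id)
      have h2 := (tendsto_coeff_of_convergesOn_closedDisc hGc).div_const c
      rw [zero_div] at h2
      simpa using h1.max h2)
  refine ⟨ω, c, hω, hlt, ht, isTame_of_tendsto hω ht fun i => hF1 ▸ hF.2.1 i,
    fun k => (le_max_left _ _).trans (hle k), fun k => ?_⟩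
  have h1 := (le_max_right _ _).trans (hle k)
  rwa [div_le_iff₀' hc0] at h1

theorem IsLwideg.isDistinguishedC (hF : IsLwideg F n) (hF1 : ‖PowerSeries.coeff n F‖ = 1)
    (hFc : ConvergesOn (closedDisc p) F)
    {f : ℕ → ℂ_[p]} (hf : ∀ k ≥ n, f k = PowerSeries.coeff k F) (d : GenericFactorization n f) :
    IsDistinguishedC F n (d.evalPoly fun i : Fin n => PowerSeries.coeff (i : ℕ) F) := by
  obtain ⟨ω, c, hω, hω1, ht, hx, hFω, -⟩ := hF.exists_gauge hF1 hFc hFc hF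
  have hle := norm_coeff_C_inv_mul_evalUnit_le hF1 hf d hω hx hFω
  refine ⟨d.monic_evalPoly, d.natDegree_evalPoly, _, convergesOn_closedDisc ?_, ?_, fun i hi => ?_,
    evalPoly_mul_evalUnit_eq hF1 hf d hω hx hFω⟩
  · exact squeeze_zero (fun _ => norm_nonneg _) hle (ht.comp tendsto_natCast_atTop_atTop)
  · refine norm_coeff_zero_C_inv_mul_evalUnit hF1 hf d hω hx hFω fun i hi => ?_
    have h1 := d.norm_coeff_evalPoly_le hω hx (by rw [hf n le_rfl, hF1])
      (fun k => by rw [hf _ (by omega)]; exact hFω k) zero_le_one le_rfl hx.norm_le_one hi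
    -- The lower coefficients of `P` are only bounded by `1` on the closed disc; strictness comes
    -- from `ω (n - i) < 1`.
    exact (mul_le_of_le_one_left (hω.nonneg _) h1).trans_lt (hω1 _ (by omega))
  · exact (hle i).trans_lt (hω1 _ (by omega))

theorem coeff_C_inv_mul_self (hn : PowerSeries.coeff n F ≠ 0) :
    PowerSeries.coeff n (PowerSeries.C (PowerSeries.coeff n F)⁻¹ * F) = 1 := by
  rw [PowerSeries.coeff_C_mul, inv_mul_cancel₀ hn]

theorem eq_C_mul_C_inv_mul (hn : PowerSeries.coeff n F ≠ 0) {P h : PowerSeries ℂ_[p]}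
    (hP : PowerSeries.C (PowerSeries.coeff n F)⁻¹ * F =
      PowerSeries.C (PowerSeries.coeff n (PowerSeries.C (PowerSeries.coeff n F)⁻¹ * F)) * P * h) :
    F = PowerSeries.C (PowerSeries.coeff n F) * P * h := by
  rw [coeff_C_inv_mul_self hn, map_one, one_mul] at hP
  rw [mul_assoc, ← hP, ← mul_assoc, ← map_mul, mul_inv_cancel₀ hn, map_one, one_mul]

theorem nonempty_genericFactorization (h1 : PowerSeries.coeff n F = 1) :
    Nonempty (GenericFactorization n fun k => PowerSeries.coeff k F) :=
  GenericFactorization.nonempty n _ (by rw [h1]; exact isUnit_one)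

/-- The generic factorisation is evaluated after dividing by `F_n`, which gives coefficient `1` at
index `n`. The same polynomial then serves for `F`. -/
theorem IsWideg.exists_isDistinguishedO (hF : IsWideg F n) : ∃ P, IsDistinguishedO F n P := by
  set F' := PowerSeries.C (PowerSeries.coeff n F)⁻¹ * F with hF'
  have h1 : PowerSeries.coeff n F' = 1 := coeff_C_inv_mul_self hF.1
  have hnorm : ∀ i, ‖PowerSeries.coeff i F'‖ =
      ‖PowerSeries.coeff n F‖⁻¹ * ‖PowerSeries.coeff i F‖ := fun i => by
    rw [hF', PowerSeries.coeff_C_mul, norm_mul, norm_inv]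
  have hpos : 0 < ‖PowerSeries.coeff n F‖⁻¹ := inv_pos.mpr (norm_pos_iff.mpr hF.1)
  have hw : IsWideg F' n := by
    refine ⟨by rw [h1]; exact one_ne_zero, fun i => ?_, fun i hi => ?_⟩
    · rw [hnorm, hnorm]
      exact mul_le_mul_of_nonneg_left (hF.2.1 i) hpos.le
    · rw [hnorm, hnorm]
      exact mul_lt_mul_of_pos_left (hF.2.2 i hi) hpos
  obtain ⟨d⟩ := nonempty_genericFactorization h1
  obtain ⟨hm, hd, hc, U, hU0, hU, hFU⟩ :=
    hw.isDistinguishedO (by rw [h1, norm_one]) (fun _ _ => rfl) d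
  exact ⟨_, hm, hd, hc, U, hU0, hU, eq_C_mul_C_inv_mul hF.1 hFU⟩

theorem IsLwideg.exists_isDistinguishedC (hF : IsLwideg F n) (hFc : ConvergesOn (closedDisc p) F) :
    ∃ P, IsDistinguishedC F n P := by
  set F' := PowerSeries.C (PowerSeries.coeff n F)⁻¹ * F with hF'
  have h1 : PowerSeries.coeff n F' = 1 := coeff_C_inv_mul_self hF.1
  have hnorm : ∀ i, ‖PowerSeries.coeff i F'‖ =
      ‖PowerSeries.coeff n F‖⁻¹ * ‖PowerSeries.coeff i F‖ := fun i => by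
    rw [hF', PowerSeries.coeff_C_mul, norm_mul, norm_inv]
  have hpos : 0 < ‖PowerSeries.coeff n F‖⁻¹ := inv_pos.mpr (norm_pos_iff.mpr hF.1)
  have hw : IsLwideg F' n := by
    refine ⟨by rw [h1]; exact one_ne_zero, fun i => ?_, fun i hi => ?_⟩
    · rw [hnorm, hnorm]
      exact mul_le_mul_of_nonneg_left (hF.2.1 i) hpos.le
    · rw [hnorm, hnorm]
      exact mul_lt_mul_of_pos_left (hF.2.2 i hi) hpos
  have hFc' : ConvergesOn (closedDisc p) F' := by
    rw [hF', ← Polynomial.coe_C]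
    exact (convergesOn_coe _ _).mul hFc
  obtain ⟨d⟩ := nonempty_genericFactorization h1
  obtain ⟨hm, hd, h, hconv, h0, hi, hFh⟩ :=
    hw.isDistinguishedC (by rw [h1, norm_one]) hFc' (fun _ _ => rfl) d
  exact ⟨_, hm, hd, h, hconv, h0, hi, eq_C_mul_C_inv_mul hF.1 hFh⟩

end Gauged

/-! ### Specialisation of the universal coefficient ring -/

section Universal

variable (n : ℕ)

/-- The variables `f_k`, `k ≥ n`, of the coefficient ring (and `0` for `k < n`). -/
def univF (k : ℕ) : UnivCoeff n :=
  if h : n ≤ k then algebraMap (MvPolynomial ({k : ℕ // n ≤ k} ⊕ ℕ) ℤ) (UnivCoeff n)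
    (MvPolynomial.X (Sum.inl ⟨k, h⟩)) else 0

/-- The variables `g_k` of the coefficient ring. -/
def univG (k : ℕ) : UnivCoeff n :=
  algebraMap (MvPolynomial ({k : ℕ // n ≤ k} ⊕ ℕ) ℤ) (UnivCoeff n) (MvPolynomial.X (Sum.inr k))

theorem isUnit_univF : IsUnit (univF n n) := by
  rw [univF, dif_pos le_rfl]
  exact IsLocalization.Away.algebraMap_isUnit _

variable {n} {F : PowerSeries ℂ_[p]} (G : PowerSeries ℂ_[p]) (h : PowerSeries.coeff n F ≠ 0)

theorem specialize_algebraMap (q : MvPolynomial ({k : ℕ // n ≤ k} ⊕ ℕ) ℤ) :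
    specialize n F G h (algebraMap _ (UnivCoeff n) q) = specializePoly n F G q :=
  IsLocalization.Away.lift_eq _ (by simpa [specializePoly] using h) q

theorem specialize_univF {k : ℕ} (hk : k ≥ n) :
    specialize n F G h (univF n k) = PowerSeries.coeff k F := by
  rw [univF, dif_pos hk, specialize_algebraMap]
  simp [specializePoly]

theorem specialize_univG (k : ℕ) : specialize n F G h (univG n k) = PowerSeries.coeff k G := by
  rw [univG, specialize_algebraMap]
  simp [specializePoly]

/-- The value of the universal resultant at `F` and `G`. -/
theorem hasUnivValue_resultantSeries (d : GenericFactorization n (univF n))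
    (hF1 : ‖PowerSeries.coeff n F‖ = 1) {ω : ℤ → ℝ} (hω : IsGauge ω)
    (hx : GenericFactorization.IsTame ω fun i : Fin n => PowerSeries.coeff (i : ℕ) F)
    (hFω : ∀ k : ℕ, ‖PowerSeries.coeff (n + k) F‖ ≤ ω k) {c : ℝ}
    (hG : ∀ k : ℕ, ‖PowerSeries.coeff k G‖ ≤ c * ω k) {D : Set ℂ_[p]} (hGD : ConvergesOn D G)
    {U : PowerSeries ℂ_[p]}
    (hP : IsPrepared D F n ((d.map (specialize n F G h)).evalPoly
      fun i : Fin n => PowerSeries.coeff (i : ℕ) F) U) (N : ℕ) :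
    HasUnivValue n (d.resultantSeries (univG n) N) F G h (discResultant D n N F G) := by
  have hf : ∀ k ≥ n, (specialize n F G h ∘ univF n) k = PowerSeries.coeff k F := fun k hk =>
    specialize_univF G h hk
  have hg : ∀ k, (specialize n F G h ∘ univG n) k = PowerSeries.coeff k G := fun k =>
    specialize_univG G h k
  have h1 := (d.map (specialize n F G h)).hasSum_resultantSeries hω hx
    (by rw [hf n le_rfl, hF1]) (fun k => by rw [hf _ (by omega)]; exact hFω k)
    (g := specialize n F G h ∘ univG n) (c := c) (fun k => by rw [hg]; exact hG k)
    (fun z hz => by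
      simp only [hg]
      exact hGD z (hP.mem_of_isRoot z (Polynomial.isRoot_of_mem_roots hz))) N
  rw [d.map_resultantSeries, hf n le_rfl] at h1
  simp only [hg, MvPowerSeries.coeff_map] at h1
  rw [hP.discResultant_eq]
  exact h1

end Universal

end PadicResultant
end

theorem theorem2p1 (p : ℕ) [Fact p.Prime] :
    -- the open unit disc: existence and comparison with the distinguished polynomials
    (∀ (F G : PowerSeries ℂ_[p]) (n N : ℕ),
      ConvergesOn (openDisc p) F → ConvergesOn (openDisc p) G → IsWideg F n → IsWideg G N →
      ResultantExists (openDisc p) n F G ∧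
      (∃ P, IsDistinguishedO F n P) ∧ (∃ Q, IsDistinguishedO G N Q) ∧
      ∀ P Q : Polynomial ℂ_[p], IsDistinguishedO F n P → IsDistinguishedO G N Q →
        ResultantComparison (openDisc p) n N F G (resO n N F G)
          (Polynomial.C (PowerSeries.coeff n F) * P)
          (Polynomial.C (PowerSeries.coeff N G) * Q)) ∧
    -- the open unit disc: the universal power series
    (∀ n N : ℕ, ∃ Φ : MvPowerSeries (Fin n) (UnivCoeff n),
      ∀ F G : PowerSeries ℂ_[p],
      ConvergesOn (openDisc p) F → ConvergesOn (openDisc p) G →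
      ∀ (hF : IsWideg F n), IsWideg G N → ‖PowerSeries.coeff n F‖ = 1 →
        HasUnivValue n Φ F G hF.1 (resO n N F G)) ∧
    -- the closed unit disc: the degree is finite
    (∀ F : PowerSeries ℂ_[p], F ≠ 0 → ConvergesOn (closedDisc p) F → ∃ m, IsLwideg F m) ∧
    -- the closed unit disc: existence and comparison with the distinguished polynomials
    (∀ (F G : PowerSeries ℂ_[p]) (m M : ℕ),
      ConvergesOn (closedDisc p) F → ConvergesOn (closedDisc p) G →
      IsLwideg F m → IsLwideg G M →
      ResultantExists (closedDisc p) m F G ∧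
      (∃ P, IsDistinguishedC F m P) ∧ (∃ Q, IsDistinguishedC G M Q) ∧
      ∀ P Q : Polynomial ℂ_[p], IsDistinguishedC F m P → IsDistinguishedC G M Q →
        ResultantComparison (closedDisc p) m M F G (resC m M F G)
          (Polynomial.C (PowerSeries.coeff m F) * P)
          (Polynomial.C (PowerSeries.coeff M G) * Q)) ∧
    -- the closed unit disc: the universal power series
    (∀ m M : ℕ, ∃ Φ : MvPowerSeries (Fin m) (UnivCoeff m),
      ∀ F G : PowerSeries ℂ_[p],
      ConvergesOn (closedDisc p) F → ConvergesOn (closedDisc p) G →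
      ∀ (hF : IsLwideg F m), IsLwideg G M → ‖PowerSeries.coeff m F‖ = 1 →
        HasUnivValue m Φ F G hF.1 (resC m M F G)) := by
  refine ⟨fun F G n N _ hGc hF hG => ?_, fun n N => ?_, fun F hF hFc => exists_isLwideg hF hFc,
    fun F G m M hFc hGc hF hG => ?_, fun m M => ?_⟩
  · obtain ⟨P₀, hP₀⟩ := hF.exists_isDistinguishedO
    obtain ⟨h₀, H₀⟩ := hP₀.isPrepared hF.1
    refine ⟨H₀.resultantExists hGc, ⟨P₀, hP₀⟩, hG.exists_isDistinguishedO, fun P Q hP hQ => ?_⟩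
    obtain ⟨h, H⟩ := hP.isPrepared hF.1
    obtain ⟨k, H'⟩ := hQ.isPrepared hG.1
    exact H.resultantComparison openDisc_subset H'
  -- The factorisation is chosen over the universal ring before `F` and `G` appear, which is what
  -- makes `Φ` independent of them. `N` enters only through the factor `f_n ^ N`.
  · obtain ⟨d⟩ := GenericFactorization.nonempty n _ (isUnit_univF n)
    refine ⟨d.resultantSeries (univG n) N, fun F G _ hGc hF hG hF1 => ?_⟩
    obtain ⟨U, HU⟩ := (hF.isDistinguishedO hF1 (fun k hk => specialize_univF G hF.1 hk)
      (d.map (specialize n F G hF.1))).isPrepared hF.1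
    exact hasUnivValue_resultantSeries G hF.1 d hF1 isGauge_boundedGauge (hF.isTame hF1)
      (fun k => by simpa [hF1] using hF.norm_coeff_le k (n + k)) (fun k => hG.norm_coeff_le k k)
      hGc HU N
  · obtain ⟨P₀, hP₀⟩ := hF.exists_isDistinguishedC hFc
    obtain ⟨h₀, H₀⟩ := hP₀.isPrepared hF
    refine ⟨H₀.resultantExists hGc, ⟨P₀, hP₀⟩, hG.exists_isDistinguishedC hGc,
      fun P Q hP hQ => ?_⟩
    obtain ⟨h, H⟩ := hP.isPrepared hF
    obtain ⟨k, H'⟩ := hQ.isPrepared hG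
    exact H.resultantComparison subset_rfl H'
  · obtain ⟨d⟩ := GenericFactorization.nonempty m _ (isUnit_univF m)
    refine ⟨d.resultantSeries (univG m) M, fun F G hFc hGc hF hG hF1 => ?_⟩
    obtain ⟨U, HU⟩ := (hF.isDistinguishedC hF1 hFc (fun k hk => specialize_univF G hF.1 hk)
      (d.map (specialize m F G hF.1))).isPrepared hF
    -- The gauge depends on the pair `F`, `G` but is used only to prove convergence and compute the
    -- sum; the series `Φ` is already fixed.
    obtain ⟨ω, c, hω, -, -, hx, hFω, hGω⟩ := hF.exists_gauge hF1 hFc hGc hG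
    exact hasUnivValue_resultantSeries G hF.1 d hF1 hω hx hFω hGω hGc HU M
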